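/- Let $p$ be an odd prime. A $p$-adic field is a finite extension $F$ of $\mathbb{Q}_p$; write $\mathcal{O}_F$ for its ring of integers. A Hopf–Galois structure on a finite extension $L/K$ is a finite-dimensional cocommutative $K$-Hopf algebra $H$ together with a $K$-linear action of $H$ on $L$ that makes $L$ an $H$-module algebra and for which the map $L\otimes_K H\to\mathrm{End}_K(L)$, $x\otimes h\mapsto (y\mapsto x(h\cdot y))$, is bijective; Hopf–Galois structures are identified when there is an isomorphism of Hopf algebras compatible with the actions. If $L/K$ is an extension of $p$-adic fields, the associated order is $\mathfrak{A}_H=\{h\in H : h\cdot\mathcal{O}_L\subseteq\mathcal{O}_L\}$. A separable extension $L/K$ with normal closure $\widetilde L$ is almost classically Galois with Galois complement $M$ if $\mathrm{Gal}(\widetilde L/K)$ has a normal subgroup $J$ that is a complement of $\mathrm{Gal}(\widetilde L/L)$ and $M=\widetilde L^{J}$. Let $L/K$ be a totally ramified extension of $p$-adic fields of degree $p$, with normal closure $\widetilde L$, and let $L'$ (resp. $K'$) be the inertia field of $\widetilde L/L$ (resp. $\widetilde L/K$), i.e. the fixed field in $\widetilde L$ of the inertia group. Then $K'\subseteq L'$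 and: 1. $L'/K'$ is an extension of $p$-adic fields of degree $p$ whose normal closure is $\widetilde L$, and it admits a Hopf–Galois structure. 2. $\widetilde L/K'$ is totally ramified. 3. $L/K$ is almost classically Galois, and if $M$ is a Galois complement of $L/K$, then $K'\subseteq M$ and $L'/K'$ is almost classically Galois with Galois complement $M$. Moreover $L/K$ admits a Hopf–Galois structure, and for every Hopf–Galois structure $H$ on $L/K$: 4. There is exactly one action of the $K'$-Hopf algebra $H'=K'\otimes_K H$ on $L'$ by $K'$-linear maps with $(a\otimes h)\cdot x=a\,(h\cdot x)$ for $a\in K'$, $h\in H$, $x\in L$; with this action $H'$ is a Hopf–Galois structure on $L'/K'$, and it is the only one. 5. The natural map $\mathcal{O}_{K'}\otimes_{\mathcal{O}_K}\mathfrak{A}_H\to K'\otimes_K H$, $a\otimes h\mapsto a\otimes h$, is an isomorphism of $\mathcal{O}_{K'}$-algebras onto $\mathfrak{A}_{H'}$, and $\mathcal{O}_{L'}$ is a free $\mathfrak{A}_{H'}$-module if and only if $\mathcal{O}_L$ is a free $\mathfrak{A}_H$-module. -/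

import Mathlib

open scoped TensorProduct

universe u v w z

noncomputable section

namespace HopfGaloisDegP

instance intermediateFieldTower (p : ℕ) [Fact p.Prime] {K : Type*} {N : Type*} [Field K] [Field N]
    [Algebra K N] [Algebra ℤ_[p] K] [Algebra ℤ_[p] N] [IsScalarTower ℤ_[p] K N]
    (S : IntermediateField K N) : IsScalarTower ℤ_[p] S N where
  smul_assoc r s n := by
    change (r • (s : N)) * n = r • ((s : N) * n)
    exact smul_mul_assoc r (s : N) n

/-! ### Rings of integers of `p`-adic fields, ramification, inertia fields -/

section Integers

variable (p : ℕ) [Fact p.Prime]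

/-- The ring of integers `𝒪_F` of a `p`-adic field `F`: the integral closure of `ℤ_p` in `F`. -/
abbrev intRing (F : Type*) [Field F] [Algebra ℤ_[p] F] : Subalgebra ℤ_[p] F :=
  integralClosure ℤ_[p] F

/-- The maximal ideal of the local ring `𝒪_F`, written as its Jacobson radical
(the intersection of all maximal ideals). -/
def maxIdeal (F : Type*) [Field F] [Algebra ℤ_[p] F] : Ideal (intRing p F) :=
  Ring.jacobson (intRing p F)

variable (F E : Type*) [Field F] [Field E] [Algebra ℤ_[p] F] [Algebra ℤ_[p] E] [Algebra F E]
  [IsScalarTower ℤ_[p] F E]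

/-- The inclusion `𝒪_F → 𝒪_E` for an extension `E/F`. -/
def intRingMap : intRing p F →+* intRing p E :=
  ((algebraMap F E).comp (intRing p F).val.toRingHom).codRestrict (intRing p E)
    (fun x => IsIntegral.map (IsScalarTower.toAlgHom ℤ_[p] F E) x.2)

instance intRingAlgebra : Algebra (intRing p F) (intRing p E) :=
  (intRingMap p F E).toAlgebra

/-- `E/F` is totally ramified: its ramification index equals its degree. -/
def IsTotallyRamified : Prop :=
  (maxIdeal p E).ramificationIdx (intRing p F) = Module.finrank F E

/-- The inertia group of `E/F`: the automorphisms acting trivially on `𝒪_E / 𝔭_E`. -/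
def inertiaGroup : Subgroup (E ≃ₐ[F] E) :=
  (maxIdeal p E).inertia (E ≃ₐ[F] E)

/-- The inertia field of `E/F`: the fixed field of the inertia group. -/
def inertiaField : IntermediateField F E :=
  IntermediateField.fixedField (inertiaGroup p F E)

end Integers

/-! ### Almost classically Galois extensions -/

section AlmostClassical

variable {K : Type*} {N : Type*} [Field K] [Field N] [Algebra K N]

/-- `L/K` (with normal closure `N`) is almost classically Galois with Galois complement `M`:
`L/K` is separable and there is a normal subgroup `J` of `Gal(N/K)` which is a complement of
`Gal(N/L)` and whose fixed field is `M`. -/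
structure IsAlmostClassicallyGaloisWith (L M : IntermediateField K N) : Prop where
  separable : Algebra.IsSeparable K L
  normalClosure : IsNormalClosure K L N
  complement : ∃ J : Subgroup (N ≃ₐ[K] N), J.Normal ∧
    Subgroup.IsComplement' J L.fixingSubgroup ∧ M = IntermediateField.fixedField J

end AlmostClassical

/-! ### Hopf-Galois structures -/

section HopfGalois

variable {K : Type*} {L : Type*} {H : Type*} [Field K] [Field L] [Algebra K L] [Ring H]
  [HopfAlgebra K H]

/-- A `K`-linear action of `H` on `L`, as an algebra homomorphism `h ↦ (x ↦ h · x)`. -/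
abbrev HopfAction (K : Type*) (L : Type*) (H : Type*) [Field K] [Field L] [Algebra K L] [Ring H]
    [HopfAlgebra K H] : Type _ :=
  H →ₐ[K] Module.End K L

/-- The map `j : L ⊗ H → End_K L`, `x ⊗ h ↦ (y ↦ x (h · y))`, of an action `ρ` of `H` on `L`. -/
def jMap (ρ : HopfAction K L H) : L ⊗[K] H →ₗ[K] Module.End K L :=
  LinearMap.mul' K (Module.End K L) ∘ₗ
    TensorProduct.map (Algebra.lmul K L).toLinearMap ρ.toLinearMap

/-- A `K`-linear action `ρ` of the `K`-Hopf algebra `H` on `L` is a Hopf-Galois structure on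
`L/K`: `H` is finite-dimensional and cocommutative, `L` is an `H`-module algebra
(`h · 1 = ε(h) 1` and `h · (x y) = ∑ (h₁ · x) (h₂ · y)`), and `j` is bijective. -/
structure IsHopfGalois (ρ : HopfAction K L H) : Prop where
  finite : FiniteDimensional K H
  cocomm : Coalgebra.IsCocomm K H
  map_one : ∀ h : H, ρ h 1 = algebraMap K L (Coalgebra.counit (R := K) h)
  map_mul : ∀ (h : H) (x y : L), ρ h (x * y) =
    LinearMap.mul' K L (TensorProduct.map (ρ.toLinearMap.flip x) (ρ.toLinearMap.flip y)
      (Coalgebra.comul (R := K) h))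
  bijective : Function.Bijective (jMap ρ)

/-- `ρ` is the only Hopf-Galois structure on `L/K`, up to isomorphisms of Hopf algebras that
are compatible with the actions. -/
def IsUniqueHopfGalois (ρ : HopfAction K L H) : Prop :=
  IsHopfGalois ρ ∧
    ∀ (H₁ : Type w) [Ring H₁] [HopfAlgebra K H₁] (ρ₁ : HopfAction K L H₁),
      IsHopfGalois ρ₁ → ∃ φ : H₁ ≃ₐc[K] H, ∀ h : H₁, ρ (φ h) = ρ₁ h

end HopfGalois

/-- The extension `L/K` is Hopf-Galois: it admits some Hopf-Galois structure. -/
def IsHopfGaloisExtension (K : Type u) (L : Type v) [Field K] [Field L] [Algebra K L] : Prop :=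
  ∃ (H : Type v) (_ : Ring H) (_ : HopfAlgebra K H) (ρ : HopfAction K L H), IsHopfGalois ρ

/-! ### Associated orders -/

section AssociatedOrder

variable (p : ℕ) [Fact p.Prime] {K : Type*} {L : Type*} {H : Type*} [Field K] [Field L]
  [Algebra K L] [Algebra ℤ_[p] K] [Algebra ℤ_[p] L] [IsScalarTower ℤ_[p] K L] [Ring H]
  [HopfAlgebra K H]

/-- The associated order `𝔄_H = {h ∈ H | h · 𝒪_L ⊆ 𝒪_L}`. -/
def associatedOrder (ρ : HopfAction K L H) : Subalgebra (intRing p K) H where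
  carrier := {h | ∀ x ∈ intRing p L, ρ h x ∈ intRing p L}
  mul_mem' := by
    intro a b ha hb x hx
    rw [map_mul]
    exact ha _ (hb x hx)
  add_mem' := by
    intro a b ha hb x hx
    rw [map_add]
    exact add_mem (ha x hx) (hb x hx)
  algebraMap_mem' := by
    intro r x hx
    have h : algebraMap (intRing p K) H r = algebraMap K H (r : K) := rfl
    rw [h, AlgHom.commutes, Module.algebraMap_end_apply, Algebra.smul_def]
    exact mul_mem (IsIntegral.map (IsScalarTower.toAlgHom ℤ_[p] K L) r.2) hx

/-- The action of the associated order on `𝒪_L`. -/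
abbrev associatedOrderModule (ρ : HopfAction K L H) :
    Module (associatedOrder p ρ) (intRing p L) where
  smul a x := ⟨ρ a.1 x.1, a.2 x.1 x.2⟩
  one_smul x := Subtype.ext (by change ρ 1 x.1 = x.1; simp)
  mul_smul a b x := Subtype.ext (by
    change ρ (a.1 * b.1) x.1 = ρ a.1 (ρ b.1 x.1); simp)
  smul_zero a := Subtype.ext (map_zero (ρ a.1))
  smul_add a x y := Subtype.ext (map_add (ρ a.1) x.1 y.1)
  add_smul a b x := Subtype.ext (by
    change ρ (a.1 + b.1) x.1 = ρ a.1 x.1 + ρ b.1 x.1; simp)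
  zero_smul x := Subtype.ext (by change ρ 0 x.1 = 0; simp)

/-- `𝒪_L` is free as a module over the associated order `𝔄_H`. -/
def IsFreeOverAssociatedOrder (ρ : HopfAction K L H) : Prop :=
  letI := associatedOrderModule p ρ
  Module.Free (associatedOrder p ρ) (intRing p L)

end AssociatedOrder

end HopfGaloisDegP

end

open HopfGaloisDegP

/-!
Let `G = Gal(N/K)`, with wild inertia group `W`. Since `G` acts faithfully on the `p` cosets of
`Gal(N/L)`, the order of `Gal(N/L)` is prime to `p`, while total ramification of `L/K` makes `p`
divide the order of the inertia group, hence that of the `p`-group `W`. So `W` is a normal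
complement of `Gal(N/L)`, the only one, and it has order `p`. As `K'` is fixed by `W`, restriction
to `Gal(N/K')` preserves complements of `Gal(N/L)`, and `L' = K'L = K' ⊗ L`; because `K'/K` is
unramified, also `𝒪_{L'} = 𝒪_{K'} ⊗ 𝒪_L`.

A normal complement `J` of `Gal(N/L)` that is abelian gives the Hopf-Galois structure `N[J]^G`. For
uniqueness in degree `p`, write the action of an arbitrary Hopf-Galois structure `H` as
`h ↦ ∑ eₓ(h) σₓ` over the embeddings `σₓ` of `L` in `N`. The `eₓ` are complete orthogonal
idempotents of the convolution algebra `Hom(H, N)`, so `G` permutes them. An element of `J` has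
order dividing `p` and fixes the idempotent of the inclusion `L ⊆ N`, so it fixes the `p - 1` others
as well; this forces the image of `H` in `End(L)` to be that of `N[J]^G`.

Hopf-Galois structures and associated orders are compatible with the base change to `K'`. Since `H`
is commutative, descent of freeness from `𝔄_{H'} = 𝒪_{K'} ⊗ 𝔄_H` to `𝔄_H` is the case of a
commutative semilocal ring: if a power `Mⁿ` is free, `n > 0`, then `M` is free.
-/

noncomputable section

namespace HopfGaloisDegP

/-! ### Extensions of discrete valuation rings -/

section DiscreteValuationRing

open IsLocalRing

variable (A R S : Type*) [CommRing A] [IsLocalRing A] [CommRing R] [CommRing S] [Algebra A S]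
  [Algebra R S]

variable {A S} in
theorem exists_sub_algebraMap_mem_maximalIdeal [IsLocalRing S]
    [(maximalIdeal S).LiesOver (maximalIdeal A)] (h : (maximalIdeal S).inertiaDeg A = 1) (x : S) :
    ∃ a : A, x - algebraMap A S a ∈ maximalIdeal S := by
  rw [Ideal.inertiaDeg_eq_of_isMaximal (maximalIdeal A)] at h
  let : Field (A ⧸ maximalIdeal A) := Ideal.Quotient.field _
  obtain ⟨c, hc⟩ := (finrank_eq_one_iff_of_nonzero' (1 : S ⧸ maximalIdeal S) one_ne_zero).1 h
    (Ideal.Quotient.mk _ x)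
  obtain ⟨a, rfl⟩ := Ideal.Quotient.mk_surjective c
  refine ⟨a, ?_⟩
  rw [← Ideal.Quotient.eq, ← hc, Algebra.smul_def, mul_one]
  rfl

variable [IsDomain R] [IsDiscreteValuationRing R] [IsDomain S] [IsDiscreteValuationRing S]
  [Module.Finite R S] [Module.IsTorsionFree R S]

theorem primesOver_maximalIdeal : (maximalIdeal R).primesOver S = {maximalIdeal S} :=
  IsLocalRing.primesOver_eq S (IsDiscreteValuationRing.not_a_field R)

theorem ramificationIdx_mul_inertiaDeg_maximalIdeal :
    (maximalIdeal S).ramificationIdx R * (maximalIdeal S).inertiaDeg R = Module.finrank R S := by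
  have hprimes := primesOver_maximalIdeal R S
  let : Unique ((maximalIdeal R).primesOver S) := by rw [hprimes]; infer_instance
  have hdefault : ((default : (maximalIdeal R).primesOver S) : Ideal S) = maximalIdeal S :=
    Set.mem_singleton_iff.1 (hprimes.le (Subtype.property _))
  rw [← Ideal.sum_ramification_inertia_eq_finrank (maximalIdeal R), Fintype.sum_unique, hdefault]

theorem card_inertia_maximalIdeal (G : Type*) [Group G] [Finite G] [MulSemiringAction G S]
    [IsGaloisGroup G R S] [PerfectField (maximalIdeal R).ResidueField] :
    Nat.card ((maximalIdeal S).inertia G) = (maximalIdeal S).ramificationIdx R := by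
  rw [Ideal.card_inertia_eq_ramificationIdxIn (maximalIdeal R),
    Ideal.ramificationIdxIn_eq_ramificationIdx (maximalIdeal R) (maximalIdeal S) G]

variable {R S}

theorem map_maximalIdeal_of_ramificationIdx_eq_one
    (h : (maximalIdeal S).ramificationIdx R = 1) :
    (maximalIdeal R).map (algebraMap R S) = maximalIdeal S := by
  have hne : (maximalIdeal R).map (algebraMap R S) ≠ ⊥ :=
    Ideal.map_ne_bot_of_ne_bot (IsDiscreteValuationRing.not_a_field R)
  rw [Ideal.IsDedekindDomain.ramificationIdx_eq_multiplicity (maximalIdeal R) _ hne] at h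
  obtain ⟨n, hn⟩ := exists_maximalIdeal_pow_eq_of_principal S
    (IsPrincipalIdealRing.principal _) _ hne
  rw [hn, multiplicity_pow_self (IsDiscreteValuationRing.not_a_field S)
    (Ideal.isUnit_iff.not.2 (maximalIdeal.isMaximal S).ne_top)] at h
  rw [hn, h, pow_one]

theorem span_range_algebraMap_eq_top [(maximalIdeal S).LiesOver (maximalIdeal A)]
    (hR : (maximalIdeal S).ramificationIdx R = 1) (hA : (maximalIdeal S).inertiaDeg A = 1) :
    Submodule.span R (Set.range (algebraMap A S)) = ⊤ := by
  refine top_le_iff.1 (Submodule.le_of_le_smul_of_le_jacobson_bot (I := maximalIdeal R)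
    Module.Finite.fg_top (jacobson_eq_maximalIdeal _ bot_ne_top).ge fun x _ => ?_)
  obtain ⟨a, ha⟩ := exists_sub_algebraMap_mem_maximalIdeal hA x
  rw [← sub_add_cancel x (algebraMap A S a), add_comm]
  refine Submodule.add_mem_sup (Submodule.subset_span ⟨a, rfl⟩) ?_
  rwa [Ideal.smul_top_eq_map, map_maximalIdeal_of_ramificationIdx_eq_one hR]

end DiscreteValuationRing

/-! ### Wild inertia -/

section WildInertia

open IsLocalRing

variable (S : Type*) [CommRing S] [IsLocalRing S] (G : Type*) [Group G] [MulSemiringAction G S]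

variable {S G} in
theorem smul_mem_maximalIdeal_pow (σ : G) {i : ℕ} {x : S} (hx : x ∈ maximalIdeal S ^ i) :
    σ • x ∈ maximalIdeal S ^ i := by
  have hmap : (maximalIdeal S).map (MulSemiringAction.toRingHom G S σ) ≤ maximalIdeal S := by
    rw [Ideal.map_le_iff_le_comap]
    exact fun y hy hu => hy ((MulEquiv.isUnit_map (MulSemiringAction.toRingEquiv G S σ)).1 hu)
  have hσx := Ideal.mem_map_of_mem (MulSemiringAction.toRingHom G S σ) hx
  rw [Ideal.map_pow] at hσx
  exact Ideal.pow_right_mono hmap i hσx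

/-- The wild inertia group of an action on a local ring with maximal ideal `𝔪`: the elements acting
trivially on all the quotients `𝔪 ^ i / 𝔪 ^ (i + 1)`. -/
def wildInertia : Subgroup G where
  carrier := {σ | ∀ i, ∀ x ∈ maximalIdeal S ^ i, σ • x - x ∈ maximalIdeal S ^ (i + 1)}
  one_mem' i x _ := by simp
  mul_mem' {σ τ} hσ hτ i x hx := by
    rw [mul_smul, ← sub_add_sub_cancel _ (τ • x)]
    exact add_mem (hσ i _ (smul_mem_maximalIdeal_pow τ hx)) (hτ i x hx)
  inv_mem' {σ} hσ i x hx := by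
    have h := hσ i _ (smul_mem_maximalIdeal_pow σ⁻¹ hx)
    rw [smul_inv_smul] at h
    rw [← neg_sub]
    exact neg_mem h

variable {S G}

instance wildInertia_normal : (wildInertia S G).Normal where
  conj_mem σ hσ τ i x hx := by
    have h := smul_mem_maximalIdeal_pow τ (hσ i _ (smul_mem_maximalIdeal_pow τ⁻¹ hx))
    rwa [smul_sub, smul_inv_smul, ← mul_smul, ← mul_smul] at h

theorem wildInertia_le_inertia : wildInertia S G ≤ (maximalIdeal S).inertia G := fun σ hσ x => by
  simpa using hσ 0 x (by simp)

section Noetherian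

variable [IsNoetherianRing S]

theorem eq_zero_of_forall_mem_maximalIdeal_pow {z : S} (h : ∀ i, z ∈ maximalIdeal S ^ i) :
    z = 0 := by
  rwa [← Ideal.mem_bot, ← Ideal.iInf_pow_eq_bot_of_isLocalRing (maximalIdeal S)
    (maximalIdeal.isMaximal S).ne_top, Ideal.mem_iInf]

theorem eq_one_of_mem_wildInertia_of_pow_eq_one [FaithfulSMul G S] {σ : G}
    (hσ : σ ∈ wildInertia S G) {n : ℕ} (hn : IsUnit (n : S)) (h : σ ^ n = 1) : σ = 1 := by
  refine FaithfulSMul.eq_of_smul_eq_smul fun x : S => ?_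
  rw [one_smul, ← sub_eq_zero]
  refine eq_zero_of_forall_mem_maximalIdeal_pow fun i => ?_
  induction i with
  | zero => simp
  | succ i ih =>
    have htelescope : ∑ k ∈ Finset.range n, σ ^ k • (σ • x - x) = 0 := by
      have := Finset.sum_range_sub (fun k => σ ^ k • x) n
      simpa only [h, pow_zero, one_smul, sub_self, pow_succ, mul_smul, ← smul_sub] using this
    have hcongr : ∑ k ∈ Finset.range n, (σ ^ k • (σ • x - x) - (σ • x - x)) ∈
        maximalIdeal S ^ (i + 1) :=
      sum_mem fun k _ => (pow_mem hσ k : σ ^ k ∈ wildInertia S G) i _ ih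
    rw [Finset.sum_sub_distrib, htelescope, zero_sub, neg_mem_iff, Finset.sum_const,
      Finset.card_range, nsmul_eq_mul] at hcongr
    exact (Ideal.unit_mul_mem_iff_mem _ hn).1 hcongr

theorem isPGroup_wildInertia [FaithfulSMul G S] [Finite G] (p : ℕ) [Fact p.Prime]
    [CharP (ResidueField S) p] : IsPGroup p (wildInertia S G) := by
  rintro ⟨σ, hσ⟩
  obtain ⟨a, m, hm, horder⟩ :=
    Nat.exists_eq_pow_mul_and_not_dvd (orderOf_pos σ).ne' p (Fact.out : p.Prime).ne_one
  have hunit : IsUnit (m : S) := by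
    rwa [← residue_ne_zero_iff_isUnit, map_natCast, Ne, CharP.cast_eq_zero_iff _ p]
  refine ⟨a, Subtype.ext (eq_one_of_mem_wildInertia_of_pow_eq_one (pow_mem hσ _) hunit ?_)⟩
  change (σ ^ p ^ a) ^ m = 1
  rw [← pow_mul, ← horder, pow_orderOf_eq_one]

end Noetherian

end WildInertia

section TameCharacter

open IsLocalRing

variable {S : Type*} [CommRing S] [IsDomain S] [IsDiscreteValuationRing S] {G : Type*} [Group G]
  [MulSemiringAction G S] {π : S}

theorem mul_mem_maximalIdeal_sq_iff (hπ : Irreducible π) {y : S} :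
    y * π ∈ maximalIdeal S ^ 2 ↔ y ∈ maximalIdeal S := by
  rw [hπ.maximalIdeal_eq, Ideal.span_singleton_pow, Ideal.mem_span_singleton,
    Ideal.mem_span_singleton, pow_two]
  exact mul_dvd_mul_iff_right hπ.ne_zero

theorem exists_smul_eq_mul (hπ : Irreducible π) (σ : G) : ∃ u, σ • π = u * π := by
  have hmem : π ∈ maximalIdeal S ^ 1 := by simpa using hπ.not_isUnit
  have h := smul_mem_maximalIdeal_pow σ hmem
  rw [pow_one, hπ.maximalIdeal_eq, Ideal.mem_span_singleton'] at h
  exact h.imp fun _ => Eq.symm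

theorem pow_smul_sub_pow_mul_mem (hπ : Irreducible π) {σ : G}
    (hσ : σ ∈ (maximalIdeal S).inertia G) {u : S} (hu : σ • π = u * π) (k : ℕ) :
    σ ^ k • π - u ^ k * π ∈ maximalIdeal S ^ 2 := by
  induction k with
  | zero => simp
  | succ k ih =>
    have hcongr : (σ • (u ^ k) - u ^ k) * u * π ∈ maximalIdeal S ^ 2 :=
      (mul_mem_maximalIdeal_sq_iff hπ).2 (Ideal.mul_mem_right _ _ (hσ _))
    convert add_mem (smul_mem_maximalIdeal_pow σ ih) hcongr using 1
    rw [smul_sub, ← mul_smul, ← pow_succ', MulSemiringAction.smul_mul, hu]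
    ring

theorem mem_wildInertia_iff_sub_one_mem (hπ : Irreducible π) {σ : G}
    (hσ : σ ∈ (maximalIdeal S).inertia G) {u : S} (hu : σ • π = u * π) :
    σ ∈ wildInertia S G ↔ u - 1 ∈ maximalIdeal S := by
  refine ⟨fun h => ?_, fun h i x hx => ?_⟩
  · rw [← mul_mem_maximalIdeal_sq_iff hπ, sub_mul, one_mul, ← hu]
    exact h 1 π (by simpa using hπ.not_isUnit)
  · obtain ⟨y, rfl⟩ : ∃ y, y * π ^ i = x := by
      rwa [hπ.maximalIdeal_eq, Ideal.span_singleton_pow, Ideal.mem_span_singleton'] at hx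
    have hy : u ^ i * (σ • y) - y ∈ maximalIdeal S := by
      have hui : u ^ i - 1 ∈ maximalIdeal S :=
        Ideal.mem_of_dvd _ (by simpa using sub_dvd_pow_sub_pow u 1 i) h
      convert add_mem (Ideal.mul_mem_right (σ • y) _ hui) (hσ y) using 1
      ring
    have hπi : π ^ i ∈ maximalIdeal S ^ i := Ideal.pow_mem_pow (by simpa using hπ.not_isUnit) i
    rw [MulSemiringAction.smul_mul, smul_pow', hu, pow_succ]
    convert Ideal.mul_mem_mul hπi hy using 1
    ring

variable (p : ℕ) [Fact p.Prime] [CharP (ResidueField S) p]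

-- The action on `𝔪 / 𝔪 ^ 2` embeds `inertia / wildInertia` into the units of the residue field,
-- where `u ^ p = 1` forces `u = 1`.
theorem mem_wildInertia_of_pow_mem {σ : G} (hσ : σ ∈ (maximalIdeal S).inertia G)
    (h : σ ^ p ∈ wildInertia S G) : σ ∈ wildInertia S G := by
  obtain ⟨π, hπ⟩ := IsDiscreteValuationRing.exists_irreducible S
  obtain ⟨u, hu⟩ := exists_smul_eq_mul hπ σ
  rw [mem_wildInertia_iff_sub_one_mem hπ hσ hu, ← residue_eq_zero_iff, map_sub, map_one]
  have hpow : u ^ p - 1 ∈ maximalIdeal S := by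
    rw [← mul_mem_maximalIdeal_sq_iff hπ, sub_mul, one_mul]
    convert sub_mem (h 1 π (by simpa using hπ.not_isUnit))
      (pow_smul_sub_pow_mul_mem hπ hσ hu p) using 1
    ring
  rw [← residue_eq_zero_iff, map_sub, map_pow, map_one] at hpow
  refine eq_zero_of_pow_eq_zero (n := p) ?_
  rw [sub_pow_char, one_pow, hpow]

theorem dvd_card_wildInertia [Finite G] (h : p ∣ Nat.card ((maximalIdeal S).inertia G)) :
    p ∣ Nat.card (wildInertia S G) := by
  have hp : p.Prime := Fact.out
  let W := (wildInertia S G).subgroupOf ((maximalIdeal S).inertia G)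
  have hcard : Nat.card W = Nat.card (wildInertia S G) :=
    Nat.card_congr (Subgroup.subgroupOfEquivOfLe wildInertia_le_inertia).toEquiv
  rw [← hcard]
  by_contra hW
  rw [Subgroup.card_eq_card_quotient_mul_card_subgroup W, hp.dvd_mul] at h
  obtain ⟨q, hq⟩ := exists_prime_orderOf_dvd_card' p (h.resolve_right hW)
  obtain ⟨σ, rfl⟩ := QuotientGroup.mk_surjective q
  have hpow : σ ^ p ∈ W := by
    rw [← QuotientGroup.eq_one_iff, QuotientGroup.mk_pow, ← hq, pow_orderOf_eq_one]
  have hσ : σ ∈ W := mem_wildInertia_of_pow_mem p σ.2 hpow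
  rw [(QuotientGroup.eq_one_iff σ).2 hσ, orderOf_one] at hq
  exact hp.ne_one hq.symm

end TameCharacter

/-! ### Rings of integers of `p`-adic fields -/

section IntRing

variable (p : ℕ) [Fact p.Prime] (F : Type*) [Field F] [Algebra ℚ_[p] F]
  [FiniteDimensional ℚ_[p] F] [Algebra ℤ_[p] F] [IsScalarTower ℤ_[p] ℚ_[p] F]

instance : IsDedekindDomain (intRing p F) :=
  have : CharZero F := charZero_of_injective_algebraMap (algebraMap ℚ_[p] F).injective
  integralClosure.isDedekindDomain ℤ_[p] ℚ_[p] F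

instance : IsFractionRing (intRing p F) F :=
  integralClosure.isFractionRing_of_finite_extension ℚ_[p] F

instance : Module.Finite ℤ_[p] (intRing p F) :=
  have : CharZero F := charZero_of_injective_algebraMap (algebraMap ℚ_[p] F).injective
  IsIntegralClosure.finite ℤ_[p] ℚ_[p] F (intRing p F)

variable {F} in
theorem mem_intRing_iff_spectralNorm_le_one (x : F) :
    x ∈ intRing p F ↔ spectralNorm ℚ_[p] F x ≤ 1 := by
  have hx : IsIntegral ℚ_[p] x := Algebra.IsIntegral.isIntegral x
  rw [spectralNorm, spectralValue_le_one_iff (minpoly.monic hx)]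
  constructor
  · intro h n
    rw [minpoly.isIntegrallyClosed_eq_field_fractions' ℚ_[p] h, Polynomial.coeff_map]
    exact PadicInt.norm_le_one _
  · intro h
    have hlifts : minpoly ℚ_[p] x ∈ Polynomial.lifts (algebraMap ℤ_[p] ℚ_[p]) := by
      rw [Polynomial.lifts_iff_coeff_lifts]
      exact fun n => ⟨⟨_, h n⟩, rfl⟩
    obtain ⟨q, hq, -, hmonic⟩ :=
      Polynomial.lifts_and_natDegree_eq_and_monic hlifts (minpoly.monic hx)
    refine ⟨q, hmonic, ?_⟩
    rw [← Polynomial.aeval_def, ← Polynomial.aeval_map_algebraMap ℚ_[p], hq, minpoly.aeval]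

instance : ValuationRing (intRing p F) := by
  rw [ValuationRing.iff_isInteger_or_isInteger (intRing p F) F]
  have hint : ∀ y : F, spectralNorm ℚ_[p] F y ≤ 1 → IsLocalization.IsInteger (intRing p F) y :=
    fun y hy => ⟨⟨y, (mem_intRing_iff_spectralNorm_le_one p y).2 hy⟩, rfl⟩
  refine fun x => (le_total (spectralNorm ℚ_[p] F x) 1).imp (hint x) fun hx => hint _ ?_
  rw [← spectralMulAlgNorm_def, map_inv₀]
  exact inv_le_one_of_one_le₀ hx

instance : FaithfulSMul ℤ_[p] (intRing p F) :=
  have : FaithfulSMul ℤ_[p] F := .trans ℤ_[p] ℚ_[p] F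
  inferInstance

instance : CharP (IsLocalRing.ResidueField (intRing p F)) p :=
  have : IsLocalHom (algebraMap ℤ_[p] (intRing p F)) := Algebra.IsIntegral.isLocalHom _ _
  have : CharP (IsLocalRing.ResidueField ℤ_[p]) p :=
    charP_of_injective_ringHom (f := (PadicInt.residueField (p := p)).symm.toRingHom)
      (PadicInt.residueField (p := p)).symm.injective p
  charP_of_injective_algebraMap (algebraMap (IsLocalRing.ResidueField ℤ_[p]) _).injective p

instance : IsDiscreteValuationRing (intRing p F) where
  toIsPrincipalIdealRing := inferInstance
  not_a_field' h := by
    have : CharZero F := charZero_of_injective_algebraMap (algebraMap ℚ_[p] F).injective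
    have hp : (p : intRing p F) ∈ IsLocalRing.maximalIdeal (intRing p F) := by
      rw [← IsLocalRing.residue_eq_zero_iff, map_natCast, CharP.cast_eq_zero]
    rw [h, Ideal.mem_bot] at hp
    simpa [(Fact.out : p.Prime).ne_zero] using congrArg Subtype.val hp

instance : PerfectField (IsLocalRing.maximalIdeal (intRing p F)).ResidueField :=
  have : IsLocalHom (algebraMap ℤ_[p] (intRing p F)) := Algebra.IsIntegral.isLocalHom _ _
  have : Finite (IsLocalRing.ResidueField ℤ_[p]) :=
    Finite.of_equiv _ (PadicInt.residueField (p := p)).toEquiv.symm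
  have : Finite (intRing p F ⧸ IsLocalRing.maximalIdeal (intRing p F)) :=
    IsLocalRing.ResidueField.finite_of_finite (R := ℤ_[p]) (S := intRing p F) this
  have : Finite (IsLocalRing.maximalIdeal (intRing p F)).ResidueField :=
    Finite.of_surjective _ (Ideal.bijective_algebraMap_quotient_residueField _).2
  inferInstance

theorem maxIdeal_eq_maximalIdeal : maxIdeal p F = IsLocalRing.maximalIdeal (intRing p F) := by
  rw [maxIdeal, ← Ideal.jacobson_bot, IsLocalRing.jacobson_eq_maximalIdeal _ bot_ne_top]

end IntRing

section Extension

variable (p : ℕ) [Fact p.Prime] (F E : Type*) [Field F] [Field E] [Algebra ℤ_[p] F]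
  [Algebra ℤ_[p] E] [Algebra F E] [IsScalarTower ℤ_[p] F E]

@[simp]
theorem coe_algebraMap_intRing (x : intRing p F) :
    (algebraMap (intRing p F) (intRing p E) x : E) = algebraMap F E x := rfl

instance : IsScalarTower (intRing p F) (intRing p E) E := .of_algebraMap_eq fun _ => rfl

instance : IsScalarTower (intRing p F) F E := .of_algebraMap_eq fun _ => rfl

instance : IsScalarTower ℤ_[p] (intRing p F) (intRing p E) :=
  .of_algebraMap_eq fun x => Subtype.ext (IsScalarTower.algebraMap_apply ℤ_[p] F E x)

instance : FaithfulSMul (intRing p F) (intRing p E) :=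
  (faithfulSMul_iff_algebraMap_injective _ _).2 fun _ _ h =>
    Subtype.ext ((algebraMap F E).injective (congrArg Subtype.val h))

instance : Module.IsTorsionFree (intRing p F) (intRing p E) :=
  Module.isTorsionFree_iff_faithfulSMul.2 inferInstance

instance : Algebra.IsIntegral (intRing p F) (intRing p E) := .tower_top (R := ℤ_[p])

instance (N : Type*) [Field N] [Algebra ℤ_[p] N] [Algebra F N] [Algebra E N] [IsScalarTower F E N]
    [IsScalarTower ℤ_[p] F N] [IsScalarTower ℤ_[p] E N] :
    IsScalarTower (intRing p F) (intRing p E) (intRing p N) :=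
  .of_algebraMap_eq fun x => Subtype.ext (IsScalarTower.algebraMap_apply F E N x)

variable [Algebra ℚ_[p] E] [FiniteDimensional ℚ_[p] E] [IsScalarTower ℤ_[p] ℚ_[p] E]

instance : Module.Finite (intRing p F) (intRing p E) := .of_restrictScalars_finite ℤ_[p] _ _

instance : FaithfulSMul (E ≃ₐ[F] E) (intRing p E) where
  eq_of_smul_eq_smul {σ τ} h := by
    ext x
    obtain ⟨a, b, -, rfl⟩ := IsFractionRing.div_surjective (A := intRing p E) x
    have hcoe : ∀ y : intRing p E, σ y = τ y := fun y => congrArg Subtype.val (h y)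
    change σ ((a : E) / b) = τ ((a : E) / b)
    rw [map_div₀, map_div₀, hcoe, hcoe]

variable [Algebra ℚ_[p] F] [FiniteDimensional ℚ_[p] F] [IsScalarTower ℤ_[p] ℚ_[p] F]

instance : Module.Free (intRing p F) (intRing p E) := Module.free_of_finite_type_torsion_free'

instance : IsLocalHom (algebraMap (intRing p F) (intRing p E)) := Algebra.IsIntegral.isLocalHom _ _

instance [IsGalois F E] :
    IsGaloisGroup (E ≃ₐ[F] E) (intRing p F) (intRing p E) :=
  have : SMulDistribClass (E ≃ₐ[F] E) (intRing p E) E :=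
    ⟨fun σ x y => map_mul σ (x : E) y⟩
  .of_isFractionRing _ _ _ F E

end Extension

/-! ### Complements and normal cores in finite groups -/

section GroupTheory

variable {G : Type*} [Group G] {H J W : Subgroup G}

theorem isComplement'_of_isPGroup [Finite G] {p : ℕ} [Fact p.Prime] (hindex : H.index = p)
    (hH : ¬ p ∣ Nat.card H) (hW : IsPGroup p W) (hpW : p ∣ Nat.card W) :
    Subgroup.IsComplement' W H := by
  have hcoprime : (Nat.card W).Coprime (Nat.card H) := by
    obtain ⟨n, hn⟩ := IsPGroup.iff_card.1 hW
    rw [hn]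
    exact Nat.Coprime.pow_left n ((Nat.Prime.coprime_iff_not_dvd Fact.out).2 hH)
  have hcard : p * Nat.card H = Nat.card G := hindex ▸ H.index_mul_card
  refine Subgroup.isComplement'_of_coprime ?_ hcoprime
  have hdvd : Nat.card W ∣ p :=
    hcoprime.dvd_of_dvd_mul_right (hcard.symm ▸ W.card_subgroup_dvd_card)
  rw [← hcard, Nat.dvd_antisymm hdvd hpW]

theorem eq_of_isComplement'_of_coprime [Finite G] [W.Normal]
    (hcoprime : (Nat.card W).Coprime (Nat.card H)) (hW : Subgroup.IsComplement' W H)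
    (hJ : Subgroup.IsComplement' J H) : J = W := by
  have hcard : Nat.card J = Nat.card W := hJ.index_eq_card.symm.trans hW.index_eq_card
  refine Subgroup.eq_of_le_of_card_ge (fun x hx => ?_) hcard.ge
  have hJx : orderOf (x : G ⧸ W) ∣ Nat.card W :=
    (orderOf_map_dvd (QuotientGroup.mk' W) x).trans (hcard ▸ Subgroup.orderOf_dvd_natCard J hx)
  have hHx : orderOf (x : G ⧸ W) ∣ Nat.card H :=
    hW.symm.index_eq_card ▸ orderOf_dvd_natCard (x : G ⧸ W)
  rw [← QuotientGroup.eq_one_iff, ← orderOf_eq_one_iff]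
  exact Nat.eq_one_of_dvd_coprimes hcoprime hJx hHx

theorem card_dvd_factorial_index [H.FiniteIndex] (hH : H.normalCore = ⊥) :
    Nat.card G ∣ H.index.factorial := by
  have hinj : Function.Injective (MulAction.toPermHom G (G ⧸ H)) := by
    rwa [← MonoidHom.ker_eq_bot_iff, ← Subgroup.normalCore_eq_ker]
  have h := Subgroup.card_dvd_of_injective _ hinj
  rwa [Nat.card_perm] at h

theorem not_dvd_card_of_index_eq {p : ℕ} (hp : p.Prime) (hindex : H.index = p)
    (hH : H.normalCore = ⊥) : ¬ p ∣ Nat.card H := by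
  have : H.FiniteIndex := ⟨hindex ▸ hp.ne_zero⟩
  intro h
  have hdvd := card_dvd_factorial_index hH
  rw [← H.index_mul_card, hindex, ← Nat.mul_factorial_pred hp.ne_zero] at hdvd
  have hpdvd := h.trans (Nat.dvd_of_mul_dvd_mul_left hp.pos hdvd)
  exact absurd (hp.dvd_factorial.1 hpdvd) (Nat.not_le.2 (Nat.sub_one_lt hp.ne_zero))

variable {G' : Type*} [Group G'] {f : G' →* G}

theorem isComplement'_comap (hf : Function.Injective f) (hWf : W ≤ f.range)
    (hW : Subgroup.IsComplement' W H) : Subgroup.IsComplement' (W.comap f) (H.comap f) := by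
  refine Subgroup.isComplement'_of_disjoint_and_mul_eq_univ ?_ (Set.eq_univ_of_forall fun x => ?_)
  · rw [disjoint_iff, ← Subgroup.comap_inf, hW.disjoint.eq_bot, MonoidHom.comap_bot,
      (MonoidHom.ker_eq_bot_iff f).2 hf]
  · obtain ⟨⟨⟨w, hw⟩, ⟨h, hh⟩⟩, hwh : w * h = f x⟩ := hW.2 (f x)
    obtain ⟨y, rfl⟩ := hWf hw
    refine ⟨y, hw, y⁻¹ * x, ?_, mul_inv_cancel_left y x⟩
    rwa [SetLike.mem_coe, Subgroup.mem_comap, map_mul, map_inv, ← hwh, inv_mul_cancel_left]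

theorem normalCore_comap_eq_bot (hf : Function.Injective f) (hWf : W ≤ f.range)
    (hW : Subgroup.IsComplement' W H) (hH : H.normalCore = ⊥) :
    (H.comap f).normalCore = ⊥ := by
  refine (Subgroup.eq_bot_iff_forall _).2 fun σ hσ => hf ?_
  rw [map_one, ← Subgroup.mem_bot, ← hH]
  intro g
  obtain ⟨⟨⟨h, hh⟩, ⟨w, hw⟩⟩, hhw : h * w = g⟩ := hW.symm.2 g
  obtain ⟨τ, rfl⟩ := hWf hw
  have hconj : f (τ * σ * τ⁻¹) ∈ H := hσ τ
  rw [← hhw]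
  convert mul_mem (mul_mem hh hconj) (inv_mem hh) using 1
  simp only [map_mul, map_inv]
  group

end GroupTheory

section Pushout

theorem isPushout_of_span_eq_top {R S A B : Type*} [CommRing R] [Nontrivial R] [CommRing S]
    [Nontrivial S] [CommRing A] [CommRing B] [Algebra R S] [Algebra R A] [Algebra R B]
    [Algebra S B] [Algebra A B] [IsScalarTower R S B] [IsScalarTower R A B]
    [Module.Free R A] [Module.Finite R A]
    [Module.Free S B] [Module.Finite S B]
    (hspan : Submodule.span S (Set.range (algebraMap A B)) = ⊤)
    (hrank : Module.finrank S B = Module.finrank R A) : Algebra.IsPushout R S A B := by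
  let f : S ⊗[R] A →ₗ[S] B := (IsScalarTower.toAlgHom R A B).toLinearMap.liftBaseChange S
  have hf (s : S) (a : A) : f (s ⊗ₜ a) = s • algebraMap A B a :=
    LinearMap.liftBaseChange_tmul _ _ _ _
  have hsurj : Function.Surjective f := by
    rw [← LinearMap.range_eq_top, ← top_le_iff, ← hspan, Submodule.span_le]
    rintro _ ⟨a, rfl⟩
    exact ⟨1 ⊗ₜ a, by rw [hf, one_smul]⟩
  let e : B ≃ₗ[S] S ⊗[R] A :=
    LinearEquiv.ofFinrankEq _ _ (hrank.trans Module.finrank_baseChange.symm)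
  have hinj : Function.Injective f := Function.Injective.of_comp (f := e)
    (OrzechProperty.injective_of_surjective_endomorphism (e.toLinearMap ∘ₗ f)
      (e.surjective.comp hsurj))
  exact ⟨.of_equiv (.ofBijective f ⟨hinj, hsurj⟩) fun a => (hf 1 a).trans (one_smul S _)⟩

end Pushout

/-! ### Almost classically Galois extensions -/

section Galois

open scoped Pointwise

variable {K N : Type*} [Field K] [Field N] [Algebra K N]

theorem finiteDimensional_of_isNormalClosure {L : Type*} [Field L] [Algebra K L]
    [FiniteDimensional K L] (hN : IsNormalClosure K L N) : FiniteDimensional K N := by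
  have h : FiniteDimensional K (IntermediateField.normalClosure K L N) := inferInstance
  rw [(Algebra.IsAlgebraic.isNormalClosure_iff.1 hN).2] at h
  exact (IntermediateField.topEquiv (F := K) (E := N)).toLinearEquiv.finiteDimensional

theorem fixingSubgroup_normalClosure [Normal K N] (T : IntermediateField K N) :
    (IntermediateField.normalClosure K T N).fixingSubgroup = T.fixingSubgroup.normalCore := by
  ext σ
  rw [← Subgroup.zpowers_le, ← IntermediateField.le_iff_le, IntermediateField.normalClosure_def'',
    iSup_le_iff]
  have hmap (τ : N ≃ₐ[K] N) : σ ∈ (T.map (τ : N →ₐ[K] N)).fixingSubgroup ↔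
      τ⁻¹ * σ * τ ∈ T.fixingSubgroup := by
    have h : (T.map (τ : N →ₐ[K] N)).fixingSubgroup = MulAut.conj τ • T.fixingSubgroup :=
      IsGalois.map_fixingSubgroup T τ
    rw [h, Subgroup.mem_pointwise_smul_iff_inv_smul_mem, ← map_inv, MulAut.smul_def,
      MulAut.conj_apply, inv_inv]
  simp only [IntermediateField.le_iff_le, Subgroup.zpowers_le, hmap]
  refine ⟨fun h τ => ?_, fun h τ => ?_⟩
  · simpa only [inv_inv] using h τ⁻¹
  · simpa only [inv_inv] using h τ⁻¹

/-- Restriction of scalars from `Gal(N/K')` to `Gal(N/K)`. -/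
abbrev galRestrictScalars (K' : IntermediateField K N) : (N ≃ₐ[K'] N) →* (N ≃ₐ[K] N) :=
  AlgEquiv.restrictScalarsHom K

theorem injective_galRestrictScalars (K' : IntermediateField K N) :
    Function.Injective (galRestrictScalars K') := AlgEquiv.restrictScalars_injective K

theorem range_galRestrictScalars (K' : IntermediateField K N) :
    (galRestrictScalars K').range = K'.fixingSubgroup := by
  ext σ
  refine ⟨?_, fun hσ => ⟨K'.fixingSubgroupEquiv ⟨σ, hσ⟩, rfl⟩⟩
  rintro ⟨τ, rfl⟩
  exact (IntermediateField.mem_fixingSubgroup_iff _ _).2 fun x hx => τ.commutes ⟨x, hx⟩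

theorem fixingSubgroup_restrictScalars {K' : IntermediateField K N} (S : IntermediateField K' N) :
    (S.restrictScalars K).fixingSubgroup = S.fixingSubgroup.map (galRestrictScalars K') := by
  rw [← range_galRestrictScalars, ← range_galRestrictScalars, MonoidHom.map_range]
  rfl

theorem card_comap_galRestrictScalars (K' : IntermediateField K N) (J : Subgroup (N ≃ₐ[K] N)) :
    Nat.card (J.comap (galRestrictScalars K')) =
      Nat.card (K'.fixingSubgroup ⊓ J : Subgroup (N ≃ₐ[K] N)) := by
  rw [← range_galRestrictScalars, ← Subgroup.map_comap_eq,
    Subgroup.card_map_of_injective (injective_galRestrictScalars K')]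

theorem extendScalars_fixedField {K' : IntermediateField K N} {J : Subgroup (N ≃ₐ[K] N)}
    (hJ : J ≤ K'.fixingSubgroup) (hle : K' ≤ IntermediateField.fixedField J) :
    IntermediateField.extendScalars hle =
      IntermediateField.fixedField (J.comap (galRestrictScalars K')) := by
  ext x
  rw [IntermediateField.mem_extendScalars, IntermediateField.mem_fixedField_iff,
    IntermediateField.mem_fixedField_iff]
  refine ⟨fun h σ hσ => h _ hσ, fun h σ hσ => ?_⟩
  obtain ⟨τ, rfl⟩ := (range_galRestrictScalars K').ge (hJ hσ)
  exact h τ hσ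

section Compositum

variable (K' L : IntermediateField K N)

/-- The compositum `K'L`, as an extension of `K'`. -/
abbrev compositum : IntermediateField K' N :=
  IntermediateField.extendScalars (le_sup_left : K' ≤ K' ⊔ L)

instance : Algebra L (compositum K' L) :=
  (IntermediateField.inclusion (le_sup_right : L ≤ K' ⊔ L)).toAlgebra

instance : IsScalarTower K L (compositum K' L) := .of_algebraMap_eq fun _ => rfl

instance : IsScalarTower L (compositum K' L) N := .of_algebraMap_eq fun _ => rfl

theorem fixingSubgroup_compositum :
    (compositum K' L).fixingSubgroup = L.fixingSubgroup.comap (galRestrictScalars K') := by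
  ext σ
  have hσ : galRestrictScalars K' σ ∈ K'.fixingSubgroup :=
    (range_galRestrictScalars K').le ⟨σ, rfl⟩
  have hsup : σ ∈ (compositum K' L).fixingSubgroup ↔
      galRestrictScalars K' σ ∈ (K' ⊔ L).fixingSubgroup := Iff.rfl
  rw [hsup, IntermediateField.fixingSubgroup_sup, Subgroup.mem_inf, and_iff_right hσ,
    Subgroup.mem_comap]

theorem span_range_algebraMap_compositum [Algebra.IsAlgebraic K L] :
    Submodule.span K' (Set.range (algebraMap L (compositum K' L))) = ⊤ := by
  let f : K' ⊗[K] L →ₐ[K] N := Algebra.TensorProduct.productMap K'.val L.val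
  have hf : f.range = (K' ⊔ L).toSubalgebra := by
    rw [Algebra.TensorProduct.productMap_range, K'.range_val, L.range_val,
      IntermediateField.sup_toSubalgebra_of_isAlgebraic_right]
  have hspan (t : K' ⊗[K] L) : f t ∈ (Submodule.span K' (Set.range
      (algebraMap L (compositum K' L)))).map (compositum K' L).val.toLinearMap := by
    induction t with
    | zero => exact map_zero f ▸ zero_mem _
    | add s t hs ht => exact map_add f s t ▸ add_mem hs ht
    | tmul a x =>
      exact ⟨_, Submodule.smul_mem _ a (Submodule.subset_span ⟨x, rfl⟩), rfl⟩
  refine Submodule.eq_top_iff'.2 fun y => ?_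
  obtain ⟨t, ht : f t = y⟩ := hf.ge y.2
  obtain ⟨z, hz, hzt⟩ := hspan t
  exact Subtype.ext (hzt.trans ht) ▸ hz

end Compositum

variable {K' L : IntermediateField K N} {J : Subgroup (N ≃ₐ[K] N)}

theorem isComplement'_compositum (hJ : Subgroup.IsComplement' J L.fixingSubgroup)
    (hJK' : J ≤ K'.fixingSubgroup) : Subgroup.IsComplement' (J.comap (galRestrictScalars K'))
      (compositum K' L).fixingSubgroup := by
  rw [fixingSubgroup_compositum]
  exact isComplement'_comap (injective_galRestrictScalars K')
    (hJK'.trans (range_galRestrictScalars K').ge) hJ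

theorem finrank_eq_card_of_isComplement' [IsGalois K N]
    (hJ : Subgroup.IsComplement' J L.fixingSubgroup) : Module.finrank K L = Nat.card J := by
  rw [IntermediateField.finrank_eq_fixingSubgroup_index N L, hJ.index_eq_card]

theorem finrank_compositum [IsGalois K N] (hJ : Subgroup.IsComplement' J L.fixingSubgroup)
    (hJK' : J ≤ K'.fixingSubgroup) :
    Module.finrank K' (compositum K' L) = Module.finrank K L := by
  rw [finrank_eq_card_of_isComplement' (isComplement'_compositum hJ hJK'),
    finrank_eq_card_of_isComplement' hJ, card_comap_galRestrictScalars, inf_eq_right.2 hJK']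

variable [FiniteDimensional K N] [IsGalois K N]

theorem isNormalClosure_iff_normalCore_fixingSubgroup_eq_bot :
    IsNormalClosure K L N ↔ L.fixingSubgroup.normalCore = ⊥ := by
  have hsplits (x : L) : ((minpoly K x).map (algebraMap K N)).Splits := by
    rw [IntermediateField.minpoly_eq]
    exact Normal.splits inferInstance _
  rw [Algebra.IsAlgebraic.isNormalClosure_iff, and_iff_right hsplits,
    ← fixingSubgroup_normalClosure, ← IntermediateField.fixingSubgroup_top]
  exact (IsGalois.intermediateFieldEquivSubgroup (F := K) (E := N)).injective.eq_iff.symm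

theorem not_dvd_card_fixingSubgroup {p : ℕ} (hp : p.Prime) (hdeg : Module.finrank K L = p)
    (hN : IsNormalClosure K L N) : ¬ p ∣ Nat.card L.fixingSubgroup :=
  not_dvd_card_of_index_eq hp
    ((IntermediateField.finrank_eq_fixingSubgroup_index N L).symm.trans hdeg)
    (isNormalClosure_iff_normalCore_fixingSubgroup_eq_bot.1 hN)

theorem isNormalClosure_compositum (hN : IsNormalClosure K L N)
    (hJ : Subgroup.IsComplement' J L.fixingSubgroup) (hJK' : J ≤ K'.fixingSubgroup) :
    IsNormalClosure K' (compositum K' L) N := by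
  rw [isNormalClosure_iff_normalCore_fixingSubgroup_eq_bot, fixingSubgroup_compositum]
  exact normalCore_comap_eq_bot (injective_galRestrictScalars K')
    (hJK'.trans (range_galRestrictScalars K').ge) hJ
    (isNormalClosure_iff_normalCore_fixingSubgroup_eq_bot.1 hN)

theorem IsAlmostClassicallyGaloisWith.compositum {M : IntermediateField K N}
    (h : IsAlmostClassicallyGaloisWith L M) (hM : K' ≤ M) :
    IsAlmostClassicallyGaloisWith (compositum K' L) (IntermediateField.extendScalars hM) := by
  obtain ⟨-, hN, J, hJnormal, hJ, rfl⟩ := h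
  have hJK' : J ≤ K'.fixingSubgroup := (IntermediateField.le_iff_le _ _).1 hM
  exact ⟨inferInstance, isNormalClosure_compositum hN hJ hJK', _, hJnormal.comap _,
    isComplement'_compositum hJ hJK', extendScalars_fixedField hJK' hM⟩

theorem isPushout_compositum (hJ : Subgroup.IsComplement' J L.fixingSubgroup)
    (hJK' : J ≤ K'.fixingSubgroup) : Algebra.IsPushout K K' L (compositum K' L) :=
  isPushout_of_span_eq_top (span_range_algebraMap_compositum K' L) (finrank_compositum hJ hJK')

end Galois

/-! ### Ramification in extensions of `p`-adic fields -/

section Ramification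

variable (p : ℕ) [Fact p.Prime] (F E : Type*) [Field F] [Algebra ℤ_[p] F] [Field E]
  [Algebra ℤ_[p] E] [Algebra F E] [IsScalarTower ℤ_[p] F E]

/-- The wild inertia group of an extension of `p`-adic fields. -/
def wildInertiaGroup [Algebra ℚ_[p] E] [FiniteDimensional ℚ_[p] E] [IsScalarTower ℤ_[p] ℚ_[p] E] :
    Subgroup (E ≃ₐ[F] E) := wildInertia (intRing p E) (E ≃ₐ[F] E)

variable [Algebra ℚ_[p] E] [FiniteDimensional ℚ_[p] E] [IsScalarTower ℤ_[p] ℚ_[p] E]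

instance : (wildInertiaGroup p F E).Normal := wildInertia_normal

theorem wildInertiaGroup_le_inertiaGroup : wildInertiaGroup p F E ≤ inertiaGroup p F E := by
  rw [inertiaGroup, maxIdeal_eq_maximalIdeal]
  exact wildInertia_le_inertia

instance : (maxIdeal p E).IsMaximal :=
  maxIdeal_eq_maximalIdeal p E ▸ IsLocalRing.maximalIdeal.isMaximal _

theorem ramificationIdx_pos : 0 < (maxIdeal p E).ramificationIdx (intRing p F) :=
  Ideal.ramificationIdx_pos _ _

variable [Algebra ℚ_[p] F] [FiniteDimensional ℚ_[p] F] [IsScalarTower ℤ_[p] ℚ_[p] F]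

instance : (maxIdeal p E).LiesOver (maxIdeal p F) := by
  rw [maxIdeal_eq_maximalIdeal, maxIdeal_eq_maximalIdeal]
  infer_instance

theorem finrank_intRing : Module.finrank (intRing p F) (intRing p E) = Module.finrank F E :=
  (IsFractionRing.finrank_eq (intRing p F) F (intRing p E) E).symm

theorem inertiaDeg_eq_one_of_isTotallyRamified (h : IsTotallyRamified p F E) :
    (maxIdeal p E).inertiaDeg (intRing p F) = 1 := by
  have hef := ramificationIdx_mul_inertiaDeg_maximalIdeal (intRing p F) (intRing p E)
  rw [← maxIdeal_eq_maximalIdeal, finrank_intRing, ← h] at hef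
  exact Nat.eq_of_mul_eq_mul_left (ramificationIdx_pos p F E) (hef.trans (mul_one _).symm)

variable [FiniteDimensional F E] [IsGalois F E]

theorem card_inertiaGroup :
    Nat.card (inertiaGroup p F E) = (maxIdeal p E).ramificationIdx (intRing p F) := by
  rw [inertiaGroup, maxIdeal_eq_maximalIdeal, card_inertia_maximalIdeal (intRing p F)]

theorem isTotallyRamified_iff_inertiaGroup_eq_top :
    IsTotallyRamified p F E ↔ inertiaGroup p F E = ⊤ := by
  rw [IsTotallyRamified, ← card_inertiaGroup, ← IsGalois.card_aut_eq_finrank,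
    Subgroup.card_eq_iff_eq_top]

end Ramification

section InertiaField

variable (p : ℕ) [Fact p.Prime] {K N : Type*} [Field K] [Field N] [Algebra K N]
  [Algebra ℤ_[p] K] [Algebra ℤ_[p] N] [IsScalarTower ℤ_[p] K N]

instance (K' L : IntermediateField K N) : IsScalarTower ℤ_[p] K (compositum K' L) :=
  .of_algebraMap_eq fun x => Subtype.ext (IsScalarTower.algebraMap_apply ℤ_[p] K N x)

instance (K' L : IntermediateField K N) : IsScalarTower ℤ_[p] L (compositum K' L) :=
  .of_algebraMap_eq fun _ => rfl

theorem inertiaGroup_eq_comap (S : IntermediateField K N) :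
    inertiaGroup p S N = (inertiaGroup p K N).comap (galRestrictScalars S) := rfl

theorem inertiaGroup_eq_top_of_fixingSubgroup_le {S : IntermediateField K N}
    (hS : S.fixingSubgroup ≤ inertiaGroup p K N) : inertiaGroup p S N = ⊤ := by
  rw [inertiaGroup_eq_comap, ← top_le_iff, ← Subgroup.map_le_iff_le_comap,
    ← MonoidHom.range_eq_map, range_galRestrictScalars]
  exact hS

variable [FiniteDimensional K N]

theorem fixingSubgroup_inertiaField :
    (inertiaField p K N).fixingSubgroup = inertiaGroup p K N :=
  IntermediateField.fixingSubgroup_fixedField _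

theorem restrictScalars_inertiaField [IsGalois K N] (L : IntermediateField K N) :
    (inertiaField p L N).restrictScalars K = inertiaField p K N ⊔ L := by
  refine (IsGalois.intermediateFieldEquivSubgroup (F := K) (E := N)).injective ?_
  change ((inertiaField p L N).restrictScalars K).fixingSubgroup =
    (inertiaField p K N ⊔ L).fixingSubgroup
  rw [fixingSubgroup_restrictScalars, fixingSubgroup_inertiaField, inertiaGroup_eq_comap,
    Subgroup.map_comap_eq, range_galRestrictScalars, IntermediateField.fixingSubgroup_sup,
    fixingSubgroup_inertiaField, inf_comm]

variable [Algebra ℚ_[p] K] [FiniteDimensional ℚ_[p] K] [IsScalarTower ℤ_[p] ℚ_[p] K]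
  [Algebra ℚ_[p] N] [FiniteDimensional ℚ_[p] N] [IsScalarTower ℤ_[p] ℚ_[p] N]
  [IsScalarTower ℚ_[p] K N]

instance (S : IntermediateField K N) : IsScalarTower ℤ_[p] ℚ_[p] S :=
  .to₁₂₄ ℤ_[p] ℚ_[p] K S

instance (S : IntermediateField K N) : FiniteDimensional ℚ_[p] S :=
  .trans ℚ_[p] K S

variable [IsGalois K N] (L : IntermediateField K N)

variable (K N) in
theorem isTotallyRamified_inertiaField : IsTotallyRamified p (inertiaField p K N) N :=
  (isTotallyRamified_iff_inertiaGroup_eq_top p _ N).2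
    (inertiaGroup_eq_top_of_fixingSubgroup_le p (fixingSubgroup_inertiaField p).le)

theorem isTotallyRamified_compositum_inertiaField :
    IsTotallyRamified p (compositum (inertiaField p K N) L) N := by
  have : IsScalarTower ℚ_[p] (inertiaField p K N) N := .of_algebraMap_eq fun _ => rfl
  refine (isTotallyRamified_iff_inertiaGroup_eq_top p _ N).2
    (inertiaGroup_eq_top_of_fixingSubgroup_le p ?_)
  rw [(isTotallyRamified_iff_inertiaGroup_eq_top p _ N).1 (isTotallyRamified_inertiaField p K N)]
  exact le_top

theorem ramificationIdx_compositum_inertiaField :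
    (maxIdeal p (compositum (inertiaField p K N) L)).ramificationIdx (intRing p L) = 1 := by
  have : IsScalarTower ℚ_[p] (inertiaField p K N) N := .of_algebraMap_eq fun _ => rfl
  have htower := Ideal.ramificationIdx_tower (R := intRing p L)
    (maxIdeal p (compositum (inertiaField p K N) L)) (maxIdeal p N)
  rw [isTotallyRamified_compositum_inertiaField, ← card_inertiaGroup, inertiaGroup_eq_comap,
    card_comap_galRestrictScalars, ← IsGalois.card_fixingSubgroup_eq_finrank,
    fixingSubgroup_compositum, card_comap_galRestrictScalars, fixingSubgroup_inertiaField,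
    inf_comm] at htower
  exact Nat.eq_of_mul_eq_mul_right Nat.card_pos (htower.symm.trans (one_mul _).symm)

theorem inertiaDeg_compositum_inertiaField :
    (maxIdeal p (compositum (inertiaField p K N) L)).inertiaDeg
      (intRing p (inertiaField p K N)) = 1 := by
  have : IsScalarTower ℚ_[p] (inertiaField p K N) N := .of_algebraMap_eq fun _ => rfl
  have htower := Ideal.inertiaDeg_tower (R := intRing p (inertiaField p K N))
    (maxIdeal p (compositum (inertiaField p K N) L)) (maxIdeal p N)
  rw [inertiaDeg_eq_one_of_isTotallyRamified p _ N (isTotallyRamified_inertiaField p K N)] at htower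
  exact Nat.eq_one_of_mul_eq_one_right htower.symm

theorem isPushout_intRing_compositum {J : Subgroup (N ≃ₐ[K] N)}
    (hJ : Subgroup.IsComplement' J L.fixingSubgroup) (hJI : J ≤ inertiaGroup p K N) :
    Algebra.IsPushout (intRing p K) (intRing p (inertiaField p K N)) (intRing p L)
      (intRing p (compositum (inertiaField p K N) L)) := by
  have : IsScalarTower ℚ_[p] (inertiaField p K N) N := .of_algebraMap_eq fun _ => rfl
  have hpushout := isPushout_compositum hJ (hJI.trans (fixingSubgroup_inertiaField p).ge)
  refine .symm (isPushout_of_span_eq_top (span_range_algebraMap_eq_top _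
    (?_ : (IsLocalRing.maximalIdeal _).ramificationIdx (intRing p L) = 1)
    (?_ : (IsLocalRing.maximalIdeal _).inertiaDeg (intRing p (inertiaField p K N)) = 1)) ?_)
  · rw [← maxIdeal_eq_maximalIdeal, ramificationIdx_compositum_inertiaField]
  · rw [← maxIdeal_eq_maximalIdeal, inertiaDeg_compositum_inertiaField]
  · rw [finrank_intRing, finrank_intRing, ← hpushout.symm.out.equiv.finrank_eq,
      Module.finrank_baseChange]

variable {p L}

theorem finrank_dvd_card_inertiaGroup (hram : IsTotallyRamified p K L) :
    Module.finrank K L ∣ Nat.card (inertiaGroup p K N) := by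
  rw [card_inertiaGroup, Ideal.ramificationIdx_tower (maxIdeal p L) (maxIdeal p N), hram]
  exact Nat.dvd_mul_right _ _

variable (hdeg : Module.finrank K L = p) (hram : IsTotallyRamified p K L)

include hdeg hram

theorem dvd_card_wildInertiaGroup : p ∣ Nat.card (wildInertiaGroup p K N) := by
  refine dvd_card_wildInertia (p := p) ?_
  rw [← maxIdeal_eq_maximalIdeal]
  exact (dvd_of_eq hdeg.symm).trans (finrank_dvd_card_inertiaGroup hram)

theorem isComplement'_wildInertiaGroup (hN : IsNormalClosure K L N) :
    Subgroup.IsComplement' (wildInertiaGroup p K N) L.fixingSubgroup :=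
  isComplement'_of_isPGroup
    ((IntermediateField.finrank_eq_fixingSubgroup_index N L).symm.trans hdeg)
    (not_dvd_card_fixingSubgroup Fact.out hdeg hN) (isPGroup_wildInertia p)
    (dvd_card_wildInertiaGroup hdeg hram)

theorem inertiaField_le_of_isAlmostClassicallyGaloisWith {M : IntermediateField K N}
    (hM : IsAlmostClassicallyGaloisWith L M) : inertiaField p K N ≤ M := by
  obtain ⟨-, hN, J, -, hJ, rfl⟩ := hM
  have hW := isComplement'_wildInertiaGroup hdeg hram hN
  have hcoprime : (Nat.card (wildInertiaGroup p K N)).Coprime (Nat.card L.fixingSubgroup) := by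
    rw [← finrank_eq_card_of_isComplement' hW, hdeg, Nat.Prime.coprime_iff_not_dvd Fact.out]
    exact not_dvd_card_fixingSubgroup Fact.out hdeg hN
  have hJW : J = wildInertiaGroup p K N := eq_of_isComplement'_of_coprime hcoprime hW hJ
  exact IntermediateField.fixedField_antitone
    (hJW.trans_le (wildInertiaGroup_le_inertiaGroup p K N))

end InertiaField

/-! ### Galois descent -/

section Descent

variable {K N : Type*} [Field K] [Field N] [Algebra K N]

/-- The `K`-space of functions `Y → N` that commute with the actions of `Gal(N/K)`. Attaching to
such a function its values is Galois descent for the `N`-space `Y → N`. -/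
def equivariantFun {Y : Type*} (θ : (N ≃ₐ[K] N) →* Equiv.Perm Y) : Submodule K (Y → N) where
  carrier := {f | ∀ g y, f (θ g y) = g (f y)}
  add_mem' ha hb g y := by simp [ha g y, hb g y]
  zero_mem' g y := by simp
  smul_mem' c f hf g y := by simp [hf g y]

variable {Y : Type*} {θ : (N ≃ₐ[K] N) →* Equiv.Perm Y}

theorem sum_apply_mul_eq_zero_of_mem_equivariantFun {ι : Type*} {f : ι → Y → N}
    (hf : ∀ i, f i ∈ equivariantFun θ) {s : Finset ι} {c : ι → N}
    (hc : ∑ i ∈ s, c i • f i = 0) (g : N ≃ₐ[K] N) (n : N) (y : Y) :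
    ∑ i ∈ s, g (n * c i) * f i y = 0 := by
  have hf' (i : ι) : f i y = g (f i (θ g⁻¹ y)) := by
    rw [← hf i g, ← Equiv.Perm.mul_apply, ← map_mul, mul_inv_cancel, map_one,
      Equiv.Perm.one_apply]
  calc ∑ i ∈ s, g (n * c i) * f i y = g (n * (∑ i ∈ s, c i • f i) (θ g⁻¹ y)) := by
        simp only [hf', Finset.sum_apply, Pi.smul_apply, smul_eq_mul, Finset.mul_sum, map_sum,
          map_mul, mul_assoc]
    _ = 0 := by rw [hc, Pi.zero_apply, mul_zero, map_zero]

variable [FiniteDimensional K N] [IsGalois K N]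

theorem linearIndependent_of_mem_equivariantFun {ι : Type*} {f : ι → Y → N}
    (hf : ∀ i, f i ∈ equivariantFun θ) (h : LinearIndependent K f) : LinearIndependent N f := by
  rw [linearIndependent_iff'] at h ⊢
  intro s c hc i hi
  suffices htrace : ∀ n : N, Algebra.trace K N (n * c i) = 0 from
    (traceForm_nondegenerate K N).2 (c i) htrace
  intro n
  refine h s (fun j => Algebra.trace K N (n * c j)) (funext fun y => ?_) i hi
  simp only [Finset.sum_apply, Pi.smul_apply, Algebra.smul_def (A := N),
    trace_eq_sum_automorphisms, Finset.sum_mul, Pi.zero_apply]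
  rw [Finset.sum_comm]
  exact Finset.sum_eq_zero fun g _ => sum_apply_mul_eq_zero_of_mem_equivariantFun hf hc g n y

omit [IsGalois K N] in
theorem sum_smul_single_mem_equivariantFun [DecidableEq Y] (n : N) (y : Y) :
    ∑ g : N ≃ₐ[K] N, g n • (Pi.single (θ g y) 1 : Y → N) ∈ equivariantFun θ := by
  intro k z
  simp only [Finset.sum_apply, Pi.smul_apply, smul_eq_mul, map_sum, map_mul]
  refine Fintype.sum_equiv (Equiv.mulLeft k⁻¹) _ _ fun g => ?_
  have hk : k ((Equiv.mulLeft k⁻¹ g) n) = g n := by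
    rw [← AlgEquiv.mul_apply, Equiv.coe_mulLeft, mul_inv_cancel_left]
  rw [hk]
  congr 1
  simp only [Pi.single_apply, Equiv.coe_mulLeft, map_mul, Equiv.Perm.mul_apply, map_inv,
    Equiv.Perm.eq_inv_iff_eq]
  split_ifs <;> simp

variable [Finite Y]

omit [IsGalois K N] in
theorem span_equivariantFun : Submodule.span N (equivariantFun θ : Set (Y → N)) = ⊤ := by
  classical
  have := Fintype.ofFinite Y
  by_contra hne
  obtain ⟨φ, hφ, hker⟩ := Submodule.exists_le_ker_of_lt_top _ (lt_top_iff_ne_top.2 hne)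
  refine hφ ((Pi.basisFun N Y).ext fun y => ?_)
  have hrel (n : N) : ∑ g : N ≃ₐ[K] N, φ (Pi.single (θ g y) 1) * g n = 0 := by
    rw [← LinearMap.mem_ker.1 (hker (Submodule.subset_span
      (sum_smul_single_mem_equivariantFun (θ := θ) n y))), map_sum]
    simp only [map_smul, smul_eq_mul, mul_comm]
  have hDedekind : LinearIndependent N fun g : N ≃ₐ[K] N => g.toAlgHom.toLinearMap :=
    (linearIndependent_toLinearMap K N N).comp (fun g : N ≃ₐ[K] N => g.toAlgHom)
      fun g k h => AlgEquiv.ext fun x => DFunLike.congr_fun h x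
  have hφ_one := Fintype.linearIndependent_iff.1 hDedekind
    (fun g => φ (Pi.single (θ g y) 1))
    (LinearMap.ext fun n => by simpa [LinearMap.sum_apply] using hrel n) 1
  simpa using hφ_one

theorem finrank_equivariantFun : Module.finrank K (equivariantFun θ) = Nat.card Y := by
  have := Fintype.ofFinite Y
  have : FiniteDimensional K (Y → N) := .trans K N _
  let b := Module.finBasis K (equivariantFun θ)
  have hli : LinearIndependent N (fun i => (b i : Y → N)) :=
    linearIndependent_of_mem_equivariantFun (fun i => (b i).2)
      (b.linearIndependent.map' (equivariantFun θ).subtype (Submodule.ker_subtype _))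
  have hspan : ⊤ ≤ Submodule.span N (Set.range fun i => (b i : Y → N)) := by
    rw [← span_equivariantFun (θ := θ), Submodule.span_le]
    intro f hf
    have hrepr : _ = f := congrArg Subtype.val (b.sum_repr ⟨f, hf⟩)
    rw [SetLike.mem_coe, ← hrepr, Submodule.coe_sum]
    refine sum_mem fun i _ => ?_
    rw [Submodule.coe_smul, ← algebraMap_smul N]
    exact Submodule.smul_mem _ _ (Submodule.subset_span ⟨i, rfl⟩)
  have hcard := Module.finrank_eq_card_basis (Module.Basis.mk hli hspan)
  rw [Module.finrank_fintype_fun_eq_card, Fintype.card_fin] at hcard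
  rw [← hcard, Nat.card_eq_fintype_card]

end Descent

section MulTensor

variable {K N : Type*} [Field K] [Field N] [Algebra K N] {A B X Y : Type*}

section

variable [AddCommMonoid A] [Module K A] [AddCommMonoid B] [Module K B] (α : A →ₗ[K] Y → N)
  (β : B →ₗ[K] X → N)

/-- The map `A ⊗ B → (Y × X → N)` sending `a ⊗ b` to `(y, x) ↦ α(a)(y) β(b)(x)`, by which tensors
are described through their coefficients. -/
def mulTensor : A ⊗[K] B →ₗ[K] Y × X → N :=
  TensorProduct.lift (LinearMap.mk₂ K (fun a b z => α a z.1 * β b z.2)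
    (fun _ _ _ => by ext; simp [add_mul]) (fun _ _ _ => by ext; simp)
    (fun _ _ _ => by ext; simp [mul_add]) (fun _ _ _ => by ext; simp))

@[simp]
theorem mulTensor_tmul (a : A) (b : B) (y : Y) (x : X) :
    mulTensor α β (a ⊗ₜ b) (y, x) = α a y * β b x := rfl

end

variable [AddCommGroup A] [Module K A] [AddCommGroup B] [Module K B] {α : A →ₗ[K] Y → N}
  {β : B →ₗ[K] X → N} [FiniteDimensional K N] [IsGalois K N] {θ : (N ≃ₐ[K] N) →* Equiv.Perm Y}

theorem injective_mulTensor (hα : Function.Injective α) (hαθ : ∀ a, α a ∈ equivariantFun θ)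
    (hβ : Function.Injective β) : Function.Injective (mulTensor α β) := by
  rw [injective_iff_map_eq_zero]
  intro t ht
  let b := Module.Basis.ofVectorSpace K A
  obtain ⟨c, rfl⟩ := TensorProduct.eq_repr_basis_left b t
  have hli : LinearIndependent N (fun i => α (b i)) :=
    linearIndependent_of_mem_equivariantFun (fun i => hαθ _)
      (b.linearIndependent.map' α (LinearMap.ker_eq_bot.2 hα))
  have hc (i) (hi : i ∈ c.support) : c i = 0 := by
    refine (map_eq_zero_iff β hβ).1 (funext fun x => ?_)
    refine linearIndependent_iff'.1 hli c.support (fun i => β (c i) x) (funext fun y => ?_) i hi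
    have hyx := congrFun ht (y, x)
    rw [Finsupp.sum, map_sum, Finset.sum_apply] at hyx
    simpa [mul_comm] using hyx
  exact Finset.sum_eq_zero fun i hi => by simp only [hc i hi, TensorProduct.tmul_zero]

end MulTensor

/-! ### The twisted group algebra as a Hopf algebra -/

section GroupAlgebra

variable {R Γ Δ : Type*} [CommSemiring R] [Group Γ] [Group Δ]

theorem coeff_mul_eq_sum [Fintype Γ] (a b : MonoidAlgebra R Γ) (z : Γ) :
    (a * b).coeff z = ∑ x, a.coeff x * b.coeff (x⁻¹ * z) := by
  rw [MonoidAlgebra.coeff_mul_apply_left, Finsupp.sum_fintype _ _ (by simp)]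

theorem coeff_algebraMap {K : Type*} [CommSemiring K] [Algebra K R] [DecidableEq Γ] (k : K)
    (z : Γ) : (algebraMap K (MonoidAlgebra R Γ) k).coeff z =
      if z = 1 then algebraMap K R k else 0 := by
  rw [MonoidAlgebra.coe_algebraMap, Function.comp_apply, MonoidAlgebra.coeff_single,
    Finsupp.single_apply]
  exact if_congr eq_comm rfl rfl

theorem coeff_mapDomain_inl_mul_mapDomain_inr (a : MonoidAlgebra R Γ) (b : MonoidAlgebra R Δ)
    (x : Γ) (y : Δ) :
    (a.mapDomain (MonoidHom.inl Γ Δ) * b.mapDomain (MonoidHom.inr Γ Δ)).coeff (x, y) =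
      a.coeff x * b.coeff y := by
  classical
  induction a using MonoidAlgebra.induction_linear with
  | zero => simp
  | add a a' ha ha' =>
    simp only [MonoidAlgebra.mapDomain_add, add_mul, MonoidAlgebra.coeff_add, Finsupp.add_apply,
      ha, ha']
  | single u r =>
    induction b using MonoidAlgebra.induction_linear with
    | zero => simp
    | add b b' hb hb' =>
      simp only [MonoidAlgebra.mapDomain_add, mul_add, MonoidAlgebra.coeff_add, Finsupp.add_apply,
        hb, hb']
    | single v t =>
      simp only [MonoidAlgebra.mapDomain_single, MonoidAlgebra.single_mul_single,
        MonoidAlgebra.coeff_single, Finsupp.single_apply, MonoidHom.inl_apply, MonoidHom.inr_apply,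
        Prod.mk_mul_mk, mul_one, one_mul, Prod.mk.injEq]
      split_ifs <;> simp_all

theorem commute_mapDomain_inl_mapDomain_inr (a : MonoidAlgebra R Γ) (b : MonoidAlgebra R Δ) :
    Commute (a.mapDomain (MonoidHom.inl Γ Δ)) (b.mapDomain (MonoidHom.inr Γ Δ)) := by
  induction a using MonoidAlgebra.induction_linear with
  | zero => simp
  | add a a' ha ha' =>
    rw [MonoidAlgebra.mapDomain_add]
    exact ha.add_left ha'
  | single u r =>
    induction b using MonoidAlgebra.induction_linear with
    | zero => simp
    | add b b' hb hb' =>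
      rw [MonoidAlgebra.mapDomain_add]
      exact hb.add_right hb'
    | single v t =>
      rw [MonoidAlgebra.mapDomain_single, MonoidAlgebra.mapDomain_single]
      exact MonoidAlgebra.single_commute_single (MonoidHom.commute_inl_inr u v) (Commute.all r t)

theorem coeff_mapDomain_diag [DecidableEq Γ] (a : MonoidAlgebra R Γ) (x y : Γ) :
    (a.mapDomain ((MonoidHom.id Γ).prod (MonoidHom.id Γ))).coeff (x, y) =
      if x = y then a.coeff x else 0 := by
  induction a using MonoidAlgebra.induction_linear with
  | zero => simp
  | add a a' ha ha' =>
    simp only [MonoidAlgebra.mapDomain_add, MonoidAlgebra.coeff_add, Finsupp.add_apply, ha, ha']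
    split_ifs <;> simp
  | single u r =>
    simp only [MonoidAlgebra.mapDomain_single, MonoidAlgebra.coeff_single, Finsupp.single_apply,
      MonoidHom.prod_apply, MonoidHom.id_apply, Prod.mk.injEq]
    grind

end GroupAlgebra

section TwistedGroupAlgebra

variable {K N Γ : Type*} [Field K] [Field N] [Algebra K N] [Group Γ] [Finite Γ]

/-- The `K`-algebra `N[Γ]^G` of invariants of the group algebra `N[Γ]` under the semilinear action
of `G = Gal(N/K)` attached to an action `θ` of `G` on `Γ`. -/
def twistedSubalgebra (θ : (N ≃ₐ[K] N) →* MulAut Γ) : Subalgebra K (MonoidAlgebra N Γ) where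
  carrier := {a | ∀ g x, a.coeff (θ g x) = g (a.coeff x)}
  add_mem' ha hb g x := by simp [ha g x, hb g x]
  mul_mem' {a b} ha hb g x := by
    have := Fintype.ofFinite Γ
    rw [coeff_mul_eq_sum, coeff_mul_eq_sum, map_sum]
    refine (Fintype.sum_equiv (θ g).toEquiv _ _ fun y => ?_).symm
    rw [map_mul, ← ha g, ← hb g, map_mul, map_inv]
    rfl
  algebraMap_mem' k g x := by
    classical
    rw [coeff_algebraMap, coeff_algebraMap, map_eq_one_iff _ (θ g).injective]
    split_ifs <;> simp

/-- The `K`-algebra `N[Γ]^G` as a type of its own, the form of `K[Γ]` that is twisted by `θ`. It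
carries a Hopf algebra structure. -/
def TwistedGroupAlgebra (θ : (N ≃ₐ[K] N) →* MulAut Γ) : Type _ := twistedSubalgebra θ

namespace TwistedGroupAlgebra

variable (θ : (N ≃ₐ[K] N) →* MulAut Γ)

instance : Ring (TwistedGroupAlgebra θ) := inferInstanceAs (Ring (twistedSubalgebra θ))

instance : Algebra K (TwistedGroupAlgebra θ) :=
  inferInstanceAs (Algebra K (twistedSubalgebra θ))

/-- The inclusion of `N[Γ]^G` in `N[Γ]`. -/
def val : TwistedGroupAlgebra θ →ₐ[K] MonoidAlgebra N Γ := (twistedSubalgebra θ).val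

/-- The coefficients of an element of `N[Γ]^G`, as a function `Γ → N`. -/
def coeff : TwistedGroupAlgebra θ →ₗ[K] Γ → N where
  toFun a x := (val θ a).coeff x
  map_add' a b := by rw [map_add]; rfl
  map_smul' k a := by rw [map_smul]; rfl

variable {θ}

theorem coeff_apply (a : TwistedGroupAlgebra θ) (x : Γ) : coeff θ a x = (val θ a).coeff x := rfl

theorem coeff_injective : Function.Injective (coeff θ) := fun _ _ h =>
  Subtype.ext (MonoidAlgebra.ext (DFunLike.coe_injective h))

theorem ext {a b : TwistedGroupAlgebra θ} (h : ∀ x, coeff θ a x = coeff θ b x) : a = b :=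
  coeff_injective (funext h)

theorem coeff_act (a : TwistedGroupAlgebra θ) (g : N ≃ₐ[K] N) (x : Γ) :
    coeff θ a (θ g x) = g (coeff θ a x) := a.2 g x

theorem coeff_mem_equivariantFun (a : TwistedGroupAlgebra θ) :
    coeff θ a ∈ equivariantFun ((MulAut.toPerm Γ).comp θ) := coeff_act a

theorem coeff_mul [Fintype Γ] (a b : TwistedGroupAlgebra θ) (z : Γ) :
    coeff θ (a * b) z = ∑ x, coeff θ a x * coeff θ b (x⁻¹ * z) := by
  simp only [coeff_apply, map_mul, coeff_mul_eq_sum]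

theorem coeff_algebraMap [DecidableEq Γ] (k : K) (z : Γ) :
    coeff θ (algebraMap K _ k) z = if z = 1 then algebraMap K N k else 0 := by
  rw [coeff_apply, AlgHom.commutes, HopfGaloisDegP.coeff_algebraMap]

theorem coeff_one [DecidableEq Γ] (z : Γ) : coeff θ 1 z = if z = 1 then 1 else 0 := by
  simpa only [map_one] using coeff_algebraMap (θ := θ) 1 z

/-- The element of `N[Γ]^G` with given equivariant coefficients. -/
def ofCoeff (f : Γ → N) (hf : ∀ g x, f (θ g x) = g (f x)) : TwistedGroupAlgebra θ :=
  ⟨.ofCoeff (Finsupp.equivFunOnFinite.symm f), hf⟩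

variable (θ) in
/-- The diagonal action of `Gal(N/K)` on `Γ × Γ`. -/
def diagAct : (N ≃ₐ[K] N) →* MulAut (Γ × Γ) where
  toFun g := MulEquiv.prodCongr (θ g) (θ g)
  map_one' := by rw [map_one]; rfl
  map_mul' g h := by rw [map_mul]; rfl

variable (θ) in
/-- The coefficients of an element of `N[Γ]^G ⊗ N[Γ]^G`, as a function `Γ × Γ → N`. -/
abbrev tensorCoeff : TwistedGroupAlgebra θ ⊗[K] TwistedGroupAlgebra θ →ₗ[K] Γ × Γ → N :=
  mulTensor (coeff θ) (coeff θ)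

variable (θ) in
/-- The natural map `N[Γ]^G ⊗ N[Γ]^G → N[Γ × Γ]`. -/
def toProd : TwistedGroupAlgebra θ ⊗[K] TwistedGroupAlgebra θ →ₐ[K] MonoidAlgebra N (Γ × Γ) :=
  Algebra.TensorProduct.lift
    ((MonoidAlgebra.mapDomainAlgHom K N (MonoidHom.inl Γ Γ)).comp (val θ))
    ((MonoidAlgebra.mapDomainAlgHom K N (MonoidHom.inr Γ Γ)).comp (val θ))
    fun a b => commute_mapDomain_inl_mapDomain_inr (val θ a) (val θ b)

theorem coeff_toProd (t : TwistedGroupAlgebra θ ⊗[K] TwistedGroupAlgebra θ) (z : Γ × Γ) :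
    (toProd θ t).coeff z = tensorCoeff θ t z := by
  induction t with
  | zero => simp
  | add s t hs ht =>
    simp only [map_add, MonoidAlgebra.coeff_add, Finsupp.add_apply, Pi.add_apply, hs, ht]
  | tmul a b =>
    refine Eq.trans ?_ (coeff_mapDomain_inl_mul_mapDomain_inr (val θ a) (val θ b) z.1 z.2)
    exact congrArg (fun c : MonoidAlgebra N (Γ × Γ) => c.coeff z)
      (Algebra.TensorProduct.lift_tmul _ _ _ a b)

theorem toProd_mem (t : TwistedGroupAlgebra θ ⊗[K] TwistedGroupAlgebra θ) :
    toProd θ t ∈ twistedSubalgebra (diagAct θ) := by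
  induction t with
  | zero => simp
  | add s t hs ht => rw [map_add]; exact add_mem hs ht
  | tmul a b =>
    intro g z
    simp only [coeff_toProd, tensorCoeff]
    change coeff θ a (θ g z.1) * coeff θ b (θ g z.2) = g (coeff θ a z.1 * coeff θ b z.2)
    rw [map_mul, coeff_act, coeff_act]

variable (θ) in
/-- The natural map `N[Γ]^G ⊗ N[Γ]^G → N[Γ × Γ]^G`. -/
def toProdInvariants :
    TwistedGroupAlgebra θ ⊗[K] TwistedGroupAlgebra θ →ₐ[K] TwistedGroupAlgebra (diagAct θ) :=
  (toProd θ).codRestrict (twistedSubalgebra (diagAct θ)) toProd_mem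

theorem coeff_toProdInvariants (t : TwistedGroupAlgebra θ ⊗[K] TwistedGroupAlgebra θ) :
    coeff (diagAct θ) (toProdInvariants θ t) = tensorCoeff θ t := funext (coeff_toProd t)

theorem mapDomain_diag_mem (a : TwistedGroupAlgebra θ) :
    (val θ a).mapDomain ((MonoidHom.id Γ).prod (MonoidHom.id Γ)) ∈
      twistedSubalgebra (diagAct θ) := by
  classical
  rintro g ⟨x, y⟩
  refine (coeff_mapDomain_diag (val θ a) (θ g x) (θ g y)).trans ?_
  rw [coeff_mapDomain_diag, (θ g).injective.eq_iff, ← coeff_apply, coeff_act]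
  split_ifs
  · rfl
  · simp

variable (θ) in
/-- The map `N[Γ]^G → N[Γ × Γ]^G` induced by the diagonal map of `Γ`. -/
def diag : TwistedGroupAlgebra θ →ₐ[K] TwistedGroupAlgebra (diagAct θ) :=
  ((MonoidAlgebra.mapDomainAlgHom K N ((MonoidHom.id Γ).prod (MonoidHom.id Γ))).comp
    (val θ)).codRestrict (twistedSubalgebra (diagAct θ)) mapDomain_diag_mem

variable (θ) in
/-- The augmentation `N[Γ]^G → N`. -/
def augmentation : TwistedGroupAlgebra θ →ₐ[K] N :=
  ((MonoidAlgebra.lift N N Γ 1).restrictScalars K).comp (val θ)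

theorem augmentation_apply [Fintype Γ] (a : TwistedGroupAlgebra θ) :
    augmentation θ a = ∑ x, coeff θ a x := by
  refine (MonoidAlgebra.lift_apply _ _).trans ?_
  rw [Finsupp.sum_fintype _ _ (by simp)]
  simp
  rfl

variable (θ) in
/-- The antipode of `N[Γ]^G`, induced by the inversion of `Γ`. -/
def antipode : TwistedGroupAlgebra θ →ₗ[K] TwistedGroupAlgebra θ where
  toFun a := ofCoeff (fun x => coeff θ a x⁻¹) fun g x => by rw [← map_inv, coeff_act]
  map_add' _ _ := ext fun _ => rfl
  map_smul' _ _ := ext fun _ => rfl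

variable (θ) in
/-- The coefficients of an element of `N[Γ]^G ⊗ (N[Γ]^G ⊗ N[Γ]^G)`. -/
abbrev tripleCoeff : TwistedGroupAlgebra θ ⊗[K]
    (TwistedGroupAlgebra θ ⊗[K] TwistedGroupAlgebra θ) →ₗ[K] Γ × Γ × Γ → N :=
  mulTensor (coeff θ) (tensorCoeff θ)

section AntipodeFormulas

variable (t : TwistedGroupAlgebra θ ⊗[K] TwistedGroupAlgebra θ)

theorem tripleCoeff_assoc_tmul (c : TwistedGroupAlgebra θ) (x y z : Γ) :
    tripleCoeff θ (TensorProduct.assoc K _ _ _ (t ⊗ₜ[K] c)) (x, y, z) =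
      tensorCoeff θ t (x, y) * coeff θ c z := by
  induction t with
  | zero => simp
  | add s t hs ht => simp only [TensorProduct.add_tmul, map_add, Pi.add_apply, hs, ht, add_mul]
  | tmul a b => simp [mul_assoc]

theorem coeff_mul'_rTensor_antipode [Fintype Γ] (z : Γ) :
    coeff θ (LinearMap.mul' K (TwistedGroupAlgebra θ) ((antipode θ).rTensor _ t)) z =
      ∑ x, tensorCoeff θ t (x, x * z) := by
  induction t with
  | zero => simp
  | add s t hs ht => simp only [map_add, Pi.add_apply, hs, ht, Finset.sum_add_distrib]
  | tmul a b =>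
    rw [LinearMap.rTensor_tmul, LinearMap.mul'_apply, coeff_mul]
    exact Fintype.sum_equiv (Equiv.inv Γ) _ _ fun x => rfl

theorem coeff_mul'_lTensor_antipode [Fintype Γ] (z : Γ) :
    coeff θ (LinearMap.mul' K (TwistedGroupAlgebra θ) ((antipode θ).lTensor _ t)) z =
      ∑ x, tensorCoeff θ t (x, z⁻¹ * x) := by
  induction t with
  | zero => simp
  | add s t hs ht => simp only [map_add, Pi.add_apply, hs, ht, Finset.sum_add_distrib]
  | tmul a b =>
    rw [LinearMap.lTensor_tmul, LinearMap.mul'_apply, coeff_mul]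
    refine Finset.sum_congr rfl fun x _ => congrArg (coeff θ a x * ·) ?_
    change coeff θ b (x⁻¹ * z)⁻¹ = _
    rw [mul_inv_rev, inv_inv]

theorem tensorCoeff_comm (x y : Γ) :
    tensorCoeff θ (TensorProduct.comm K _ _ t) (x, y) = tensorCoeff θ t (y, x) := by
  induction t with
  | zero => simp
  | add s t hs ht => simp only [map_add, Pi.add_apply, hs, ht]
  | tmul a b => simp [mul_comm]

end AntipodeFormulas

variable [FiniteDimensional K N] [IsGalois K N]

theorem finrank_eq : Module.finrank K (TwistedGroupAlgebra θ) = Nat.card Γ := by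
  rw [← finrank_equivariantFun (θ := (MulAut.toPerm Γ).comp θ)]
  refine LinearEquiv.finrank_eq (.ofBijective
    ((coeff θ).codRestrict _ coeff_mem_equivariantFun) ⟨?_, fun f => ⟨ofCoeff f.1 f.2, rfl⟩⟩)
  exact fun a b h => coeff_injective (congrArg Subtype.val h)

instance : FiniteDimensional K (TwistedGroupAlgebra θ) :=
  .of_finrank_pos (by rw [finrank_eq]; exact Nat.card_pos)

theorem injective_tensorCoeff : Function.Injective (tensorCoeff θ) :=
  injective_mulTensor coeff_injective coeff_mem_equivariantFun coeff_injective

theorem bijective_toProdInvariants : Function.Bijective (toProdInvariants θ) := by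
  have hinj : Function.Injective (toProdInvariants θ) := fun s t h =>
    injective_tensorCoeff (by rw [← coeff_toProdInvariants, h, coeff_toProdInvariants])
  have hrank : Module.finrank K (TwistedGroupAlgebra θ ⊗[K] TwistedGroupAlgebra θ) =
      Module.finrank K (TwistedGroupAlgebra (diagAct θ)) := by
    rw [Module.finrank_tensorProduct, finrank_eq, finrank_eq, Nat.card_prod]
  exact ⟨hinj, (LinearMap.injective_iff_surjective_of_finrank_eq_finrank
    (f := (toProdInvariants θ).toLinearMap) hrank).1 hinj⟩

variable (θ) in
/-- The natural isomorphism `N[Γ]^G ⊗ N[Γ]^G ≃ N[Γ × Γ]^G`. -/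
def tensorEquiv :
    TwistedGroupAlgebra θ ⊗[K] TwistedGroupAlgebra θ ≃ₐ[K] TwistedGroupAlgebra (diagAct θ) :=
  .ofBijective (toProdInvariants θ) bijective_toProdInvariants

variable (θ) in
/-- The comultiplication of `N[Γ]^G`, induced by the diagonal map of `Γ`. -/
def comul : TwistedGroupAlgebra θ →ₐ[K] TwistedGroupAlgebra θ ⊗[K] TwistedGroupAlgebra θ :=
  (tensorEquiv θ).symm.toAlgHom.comp (diag θ)

theorem tensorCoeff_comul [DecidableEq Γ] (a : TwistedGroupAlgebra θ) (x y : Γ) :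
    tensorCoeff θ (comul θ a) (x, y) = if x = y then coeff θ a x else 0 := by
  have hcomul : toProdInvariants θ (comul θ a) = diag θ a :=
    (tensorEquiv θ).apply_symm_apply _
  rw [← coeff_toProdInvariants, hcomul]
  exact coeff_mapDomain_diag (val θ a) x y

theorem augmentation_mem_bot (a : TwistedGroupAlgebra θ) :
    augmentation θ a ∈ (⊥ : Subalgebra K N) := by
  have := Fintype.ofFinite Γ
  change _ ∈ (⊥ : IntermediateField K N)
  rw [IsGalois.mem_bot_iff_fixed]
  intro g
  rw [augmentation_apply, map_sum]
  exact Fintype.sum_equiv (θ g).toEquiv _ _ fun x => (coeff_act a g x).symm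

variable (θ) in
/-- The counit of `N[Γ]^G`. -/
def counit : TwistedGroupAlgebra θ →ₐ[K] K :=
  (Algebra.botEquiv K N).toAlgHom.comp ((augmentation θ).codRestrict ⊥ augmentation_mem_bot)

theorem algebraMap_counit [Fintype Γ] (a : TwistedGroupAlgebra θ) :
    algebraMap K N (counit θ a) = ∑ x, coeff θ a x := by
  rw [← augmentation_apply]
  exact congrArg Subtype.val ((Algebra.botEquiv K N).symm_apply_apply
    ((augmentation θ).codRestrict ⊥ (augmentation_mem_bot (θ := θ)) a))

theorem injective_tripleCoeff : Function.Injective (tripleCoeff θ) :=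
  injective_mulTensor coeff_injective coeff_mem_equivariantFun injective_tensorCoeff

section CoalgebraFormulas

variable (t : TwistedGroupAlgebra θ ⊗[K] TwistedGroupAlgebra θ)

theorem tripleCoeff_assoc_map_comul [DecidableEq Γ] (x y z : Γ) :
    tripleCoeff θ (TensorProduct.assoc K _ _ _
      (Algebra.TensorProduct.map (comul θ) (AlgHom.id K _) t)) (x, y, z) =
      if x = y then tensorCoeff θ t (x, z) else 0 := by
  induction t with
  | zero => simp
  | add s t hs ht =>
    simp only [map_add, Pi.add_apply, hs, ht]
    split_ifs <;> simp
  | tmul a b =>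
    rw [Algebra.TensorProduct.map_tmul, tripleCoeff_assoc_tmul, tensorCoeff_comul]
    split_ifs <;> simp

theorem tripleCoeff_map_comul [DecidableEq Γ] (x y z : Γ) :
    tripleCoeff θ (Algebra.TensorProduct.map (AlgHom.id K _) (comul θ) t) (x, y, z) =
      if y = z then tensorCoeff θ t (x, y) else 0 := by
  induction t with
  | zero => simp
  | add s t hs ht =>
    simp only [map_add, Pi.add_apply, hs, ht]
    split_ifs <;> simp
  | tmul a b =>
    rw [Algebra.TensorProduct.map_tmul, mulTensor_tmul, tensorCoeff_comul]
    split_ifs <;> simp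

theorem coeff_lid_map_counit [Fintype Γ] (y : Γ) :
    coeff θ (Algebra.TensorProduct.lid K (TwistedGroupAlgebra θ)
      (Algebra.TensorProduct.map (counit θ) (AlgHom.id K _) t)) y =
      ∑ x, tensorCoeff θ t (x, y) := by
  induction t with
  | zero => simp
  | add s t hs ht => simp only [map_add, Pi.add_apply, hs, ht, Finset.sum_add_distrib]
  | tmul a b =>
    simp only [Algebra.TensorProduct.map_tmul, Algebra.TensorProduct.lid_tmul, mulTensor_tmul,
      ← Finset.sum_mul, ← algebraMap_counit]
    rw [map_smul, Pi.smul_apply, Algebra.smul_def, AlgHom.id_apply]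

theorem coeff_rid_map_counit [Fintype Γ] (x : Γ) :
    coeff θ (Algebra.TensorProduct.rid K K (TwistedGroupAlgebra θ)
      (Algebra.TensorProduct.map (AlgHom.id K _) (counit θ) t)) x =
      ∑ y, tensorCoeff θ t (x, y) := by
  induction t with
  | zero => simp
  | add s t hs ht => simp only [map_add, Pi.add_apply, hs, ht, Finset.sum_add_distrib]
  | tmul a b =>
    simp only [Algebra.TensorProduct.map_tmul, Algebra.TensorProduct.rid_tmul, mulTensor_tmul,
      ← Finset.mul_sum, ← algebraMap_counit]
    rw [map_smul, Pi.smul_apply, Algebra.smul_def, AlgHom.id_apply, mul_comm]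

end CoalgebraFormulas

instance : Bialgebra K (TwistedGroupAlgebra θ) :=
  Bialgebra.ofAlgHom (comul θ) (counit θ)
    (by
      classical
      refine AlgHom.ext fun a => injective_tripleCoeff (funext fun ⟨x, y, z⟩ => ?_)
      refine (tripleCoeff_assoc_map_comul _ x y z).trans
        (Eq.trans ?_ (tripleCoeff_map_comul _ x y z).symm)
      have h := tensorCoeff_comul a
      simp only [RingHom.coe_coe] at h ⊢
      rw [h, h]
      split_ifs <;> simp_all)
    (by
      classical
      have := Fintype.ofFinite Γ
      refine AlgHom.ext fun a => (Algebra.TensorProduct.lid K (TwistedGroupAlgebra θ)).injective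
        (ext fun y => (coeff_lid_map_counit _ y).trans ?_)
      simp [tensorCoeff_comul])
    (by
      classical
      have := Fintype.ofFinite Γ
      refine AlgHom.ext fun a => (Algebra.TensorProduct.rid K K (TwistedGroupAlgebra θ)).injective
        (ext fun y => (coeff_rid_map_counit _ y).trans ?_)
      simp [tensorCoeff_comul])

theorem comul_apply (a : TwistedGroupAlgebra θ) : Coalgebra.comul (R := K) a = comul θ a := rfl

theorem counit_apply (a : TwistedGroupAlgebra θ) : Coalgebra.counit (R := K) a = counit θ a := rfl

instance : HopfAlgebra K (TwistedGroupAlgebra θ) where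
  antipode := antipode θ
  mul_antipode_rTensor_comul := by
    classical
    have := Fintype.ofFinite Γ
    refine LinearMap.ext fun a => ext fun z => (coeff_mul'_rTensor_antipode _ z).trans ?_
    refine Eq.trans ?_ (coeff_algebraMap _ z).symm
    rw [counit_apply, algebraMap_counit, comul_apply]
    simp [tensorCoeff_comul, Finset.sum_ite_irrel]
  mul_antipode_lTensor_comul := by
    classical
    have := Fintype.ofFinite Γ
    refine LinearMap.ext fun a => ext fun z => (coeff_mul'_lTensor_antipode _ z).trans ?_
    refine Eq.trans ?_ (coeff_algebraMap _ z).symm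
    rw [counit_apply, algebraMap_counit, comul_apply]
    simp [tensorCoeff_comul, Finset.sum_ite_irrel]

instance : Coalgebra.IsCocomm K (TwistedGroupAlgebra θ) where
  comm_comp_comul := by
    classical
    refine LinearMap.ext fun a => injective_tensorCoeff (funext fun ⟨x, y⟩ => ?_)
    refine (tensorCoeff_comm _ x y).trans ?_
    rw [comul_apply, tensorCoeff_comul, tensorCoeff_comul]
    split_ifs <;> simp_all

end TwistedGroupAlgebra

end TwistedGroupAlgebra

/-! ### Hopf-Galois structures are determined by their image -/

section Range

variable {K L H : Type*} [Field K] [Field L] [Algebra K L] [Ring H] [HopfAlgebra K H]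

/-- The map `a ⊗ b ↦ (a · x) (b · y)`, which takes the coproduct of `h` to `h · (x y)` when `L` is
an `H`-module algebra. -/
def tensorEval (ρ : HopfAction K L H) (x y : L) : H ⊗[K] H →ₗ[K] L :=
  LinearMap.mul' K L ∘ₗ TensorProduct.map (ρ.toLinearMap.flip x) (ρ.toLinearMap.flip y)

@[simp]
theorem tensorEval_tmul (ρ : HopfAction K L H) (x y : L) (a b : H) :
    tensorEval ρ x y (a ⊗ₜ b) = ρ a x * ρ b y := rfl

theorem jMap_tmul (ρ : HopfAction K L H) (x : L) (h : H) (y : L) :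
    jMap ρ (x ⊗ₜ h) y = x * ρ h y := rfl

theorem jMap_map_flip_comm (ρ : HopfAction K L H) (t : H ⊗[K] H) (x y : L) :
    jMap ρ ((ρ.toLinearMap.flip y).rTensor H (TensorProduct.comm K H H t)) x =
      tensorEval ρ x y t := by
  induction t with
  | zero => simp
  | add s t hs ht => simp only [map_add, LinearMap.add_apply, hs, ht]
  | tmul a b => exact mul_comm _ _

variable {ρ : HopfAction K L H}

theorem IsHopfGalois.apply_mul (hρ : IsHopfGalois ρ) (h : H) (x y : L) :
    ρ h (x * y) = tensorEval ρ x y (Coalgebra.comul (R := K) h) := hρ.map_mul h x y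

theorem IsHopfGalois.injective (hρ : IsHopfGalois ρ) : Function.Injective ρ := by
  intro a b hab
  refine Algebra.TensorProduct.includeRight_injective (A := L) (B := H)
    (algebraMap K L).injective (hρ.bijective.1 (LinearMap.ext fun y => ?_))
  change 1 * ρ a y = 1 * ρ b y
  rw [hab]

theorem IsHopfGalois.finrank_eq [FiniteDimensional K L] (hρ : IsHopfGalois ρ) :
    Module.finrank K H = Module.finrank K L := by
  have := hρ.finite
  have hrank := (LinearEquiv.ofBijective _ hρ.bijective).finrank_eq
  rw [Module.finrank_tensorProduct, Module.finrank_linearMap] at hrank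
  exact Nat.eq_of_mul_eq_mul_left Module.finrank_pos hrank

theorem eq_zero_of_forall_rTensor_flip_eq_zero (hρ : Function.Injective ρ) (t : H ⊗[K] H)
    (ht : ∀ y : L, (ρ.toLinearMap.flip y).rTensor H t = 0) : t = 0 := by
  classical
  let b := Module.Basis.ofVectorSpace K H
  have hcoord (f : H →ₗ[K] L) (t : H ⊗[K] H) (i) :
      TensorProduct.equivFinsuppOfBasisRight b (f.rTensor H t) i =
        f (TensorProduct.equivFinsuppOfBasisRight b t i) := by
    induction t with
    | zero => simp
    | add s t hs ht => simp only [map_add, Finsupp.add_apply, hs, ht]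
    | tmul a c => simp
  refine (TensorProduct.equivFinsuppOfBasisRight b).injective (Finsupp.ext fun i => hρ ?_)
  refine LinearMap.ext fun y => ?_
  refine (hcoord (ρ.toLinearMap.flip y) t i).symm.trans ?_
  simp [ht y]

theorem IsHopfGalois.eq_of_forall_tensorEval_eq (hρ : IsHopfGalois ρ) {s t : H ⊗[K] H}
    (hst : ∀ x y : L, tensorEval ρ x y s = tensorEval ρ x y t) : s = t := by
  rw [← sub_eq_zero, ← (TensorProduct.comm K H H).map_eq_zero_iff]
  refine eq_zero_of_forall_rTensor_flip_eq_zero hρ.injective _ fun y =>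
    hρ.bijective.1 (LinearMap.ext fun x => ?_)
  rw [jMap_map_flip_comm, map_sub, hst, sub_self, map_zero, LinearMap.zero_apply]

variable {H' : Type*} [Ring H'] [HopfAlgebra K H'] {ρ' : HopfAction K L H'}

theorem tensorEval_map (φ : H →ₗ[K] H') (hφ : ∀ h, ρ' (φ h) = ρ h) (t : H ⊗[K] H) (x y : L) :
    tensorEval ρ' x y (TensorProduct.map φ φ t) = tensorEval ρ x y t := by
  induction t with
  | zero => simp
  | add s t hs ht => simp only [map_add, hs, ht]
  | tmul a b => simp [hφ]

theorem exists_bialgEquiv_of_range_eq (hρ : IsHopfGalois ρ) (hρ' : IsHopfGalois ρ')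
    (hrange : ρ.range = ρ'.range) : ∃ φ : H ≃ₐc[K] H', ∀ a, ρ' (φ a) = ρ a := by
  let φ : H ≃ₐ[K] H' := (AlgEquiv.ofInjective ρ hρ.injective).trans
    ((Subalgebra.equivOfEq _ _ hrange).trans (AlgEquiv.ofInjective ρ' hρ'.injective).symm)
  have hφ : ∀ a, ρ' (φ a) = ρ a := fun a =>
    congrArg Subtype.val ((AlgEquiv.ofInjective ρ' hρ'.injective).apply_symm_apply
      ((Subalgebra.equivOfEq _ _ hrange) (AlgEquiv.ofInjective ρ hρ.injective a)))
  refine ⟨BialgEquiv.ofAlgEquiv φ ?_ ?_, hφ⟩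
  · refine AlgHom.ext fun a => (algebraMap K L).injective ?_
    change algebraMap K L (Coalgebra.counit (φ a)) = algebraMap K L (Coalgebra.counit a)
    rw [← hρ.map_one, ← hρ'.map_one, hφ]
  · refine AlgHom.ext fun a => ?_
    change TensorProduct.map φ.toLinearMap φ.toLinearMap (Coalgebra.comul a) =
      Coalgebra.comul (φ a)
    refine hρ'.eq_of_forall_tensorEval_eq fun x y => ?_
    rw [tensorEval_map φ.toLinearMap hφ, ← hρ.apply_mul, ← hρ'.apply_mul, hφ]

end Range

/-! ### The action of the twisted group algebra -/

section TwistedGroupAlgebraAction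

variable {K N Γ : Type*} [Field K] [Field N] [Algebra K N]

section RestrictHom

variable [Group Γ] (L : IntermediateField K N) (ι : Γ →* (N ≃ₐ[K] N))

/-- The restrictions to `L` of the automorphisms of `N` in the image of `ι`. -/
def restrictHom (x : Γ) : L →ₐ[K] N := (ι x).toAlgHom.comp L.val

@[simp]
theorem restrictHom_apply (x : Γ) (l : L) : restrictHom L ι x l = ι x l := rfl

variable {L ι}

theorem linearIndependent_restrictHom (hinj : Function.Injective (restrictHom L ι)) :
    LinearIndependent N fun x => (restrictHom L ι x).toLinearMap :=
  (linearIndependent_toLinearMap K L N).comp _ hinj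

theorem apply_restrictHom_of_mem_fixingSubgroup {θ : (N ≃ₐ[K] N) →* MulAut Γ}
    (hθ : ∀ g x, ι (θ g x) = g * ι x * g⁻¹) {g : N ≃ₐ[K] N} (hg : g ∈ L.fixingSubgroup) (x : Γ)
    (l : L) : g (restrictHom L ι x l) = restrictHom L ι (θ g x) l := by
  have hgl : g⁻¹ l = l :=
    (IntermediateField.mem_fixingSubgroup_iff _ _).1 (inv_mem hg) _ l.2
  rw [restrictHom_apply, restrictHom_apply, hθ, AlgEquiv.mul_apply, AlgEquiv.mul_apply, hgl]

theorem conj_apply_eq_self [IsMulCommutative Γ] {θ : (N ≃ₐ[K] N) →* MulAut Γ}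
    (hθ : ∀ g x, ι (θ g x) = g * ι x * g⁻¹) (hι : Function.Injective ι) (x y : Γ) :
    θ (ι y) x = x :=
  hι (by rw [hθ, ← map_mul, ← map_inv, ← map_mul, mul_comm' y, mul_inv_cancel_right])

end RestrictHom

namespace TwistedGroupAlgebra

variable [Group Γ] [Finite Γ] {θ : (N ≃ₐ[K] N) →* MulAut Γ}

open scoped IsMulCommutative in
theorem mul_comm [IsMulCommutative Γ] (a b : TwistedGroupAlgebra θ) : a * b = b * a :=
  Subtype.ext (_root_.mul_comm (val θ a) (val θ b))

variable (L : IntermediateField K N) {ι : Γ →* (N ≃ₐ[K] N)}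
  (hθ : ∀ g x, ι (θ g x) = g * ι x * g⁻¹)

include hθ in
theorem apply_coeff_of_injective [IsMulCommutative Γ] (hι : Function.Injective ι)
    (a : TwistedGroupAlgebra θ) (x y : Γ) : ι y (coeff θ a x) = coeff θ a x := by
  rw [← coeff_act, conj_apply_eq_self hθ hι]

variable [FiniteDimensional K N] [IsGalois K N]

/-- The coefficients of an element of `N[Γ]^G ⊗ L`. -/
abbrev lTensorCoeff (θ : (N ≃ₐ[K] N) →* MulAut Γ) :
    TwistedGroupAlgebra θ ⊗[K] L →ₗ[K] Γ × Unit → N :=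
  mulTensor (coeff θ) (LinearMap.pi fun _ => L.val.toLinearMap)

theorem injective_lTensorCoeff : Function.Injective (lTensorCoeff L θ) :=
  injective_mulTensor coeff_injective coeff_mem_equivariantFun
    fun _ _ h => Subtype.ext (congrFun h ())

include hθ in
theorem sum_coeff_mul_restrictHom_mem [Fintype Γ] (a : TwistedGroupAlgebra θ) (l : L) :
    ∑ x, coeff θ a x * restrictHom L ι x l ∈ L := by
  refine (IsGalois.fixedField_fixingSubgroup L).le ?_
  rw [IntermediateField.mem_fixedField_iff]
  intro g hg
  rw [map_sum]
  refine Fintype.sum_equiv (θ g).toEquiv _ _ fun x => ?_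
  rw [map_mul, apply_restrictHom_of_mem_fixingSubgroup hθ hg]
  exact congrArg (· * _) (coeff_act a g x).symm

/-- The action of `N[Γ]^G` on `L` as a linear map: `∑ aₓ x` sends `l` to `∑ aₓ ι(x)(l)`. -/
def actionLinearMap : TwistedGroupAlgebra θ →ₗ[K] Module.End K L :=
  letI := Fintype.ofFinite Γ
  { toFun a :=
      { toFun l :=
          ⟨∑ x, coeff θ a x * restrictHom L ι x l, sum_coeff_mul_restrictHom_mem L hθ a l⟩
        map_add' l m := Subtype.ext (by simp [mul_add, Finset.sum_add_distrib])
        map_smul' k l := Subtype.ext (by simp [Algebra.smul_def, Finset.mul_sum, mul_left_comm]) }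
    map_add' a b := by ext l; simp [add_mul, Finset.sum_add_distrib]
    map_smul' k a := by ext l; simp [Finset.smul_sum] }

theorem actionLinearMap_apply [inst : Fintype Γ] (a : TwistedGroupAlgebra θ) (l : L) :
    (actionLinearMap L hθ a l : N) = ∑ x, coeff θ a x * restrictHom L ι x l := by
  obtain rfl := Subsingleton.elim inst (Fintype.ofFinite Γ)
  rfl

theorem actionLinearMap_one : actionLinearMap L hθ (1 : TwistedGroupAlgebra θ) = 1 := by
  classical
  have := Fintype.ofFinite Γ
  ext l
  rw [actionLinearMap_apply]
  simp [coeff_one]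

variable [IsMulCommutative Γ] (hι : Function.Injective ι)

include hι in
theorem actionLinearMap_mul (a b : TwistedGroupAlgebra θ) :
    actionLinearMap L hθ (a * b) = actionLinearMap L hθ a * actionLinearMap L hθ b := by
  have := Fintype.ofFinite Γ
  ext l
  simp only [Module.End.mul_apply, actionLinearMap_apply, restrictHom_apply, map_sum, map_mul,
    apply_coeff_of_injective hθ hι, Finset.mul_sum, coeff_mul, Finset.sum_mul]
  rw [Finset.sum_comm]
  refine Finset.sum_congr rfl fun x _ => ?_
  refine Fintype.sum_equiv (Equiv.mulLeft x⁻¹) _ _ fun y => ?_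
  rw [← AlgEquiv.mul_apply, ← map_mul, Equiv.coe_mulLeft, mul_inv_cancel_left, mul_assoc]

/-- The action of the Hopf algebra `N[Γ]^G` on `L`, for `Γ` embedded in `Gal(N/K)`. -/
def action : HopfAction K L (TwistedGroupAlgebra θ) :=
  .ofLinearMap (actionLinearMap L hθ) (actionLinearMap_one L hθ) (actionLinearMap_mul L hθ hι)

theorem action_apply [Fintype Γ] (a : TwistedGroupAlgebra θ) (l : L) :
    (action L hθ hι a l : N) = ∑ x, coeff θ a x * restrictHom L ι x l :=
  actionLinearMap_apply L hθ a l

theorem tensorEval_action [Fintype Γ] (t : TwistedGroupAlgebra θ ⊗[K] TwistedGroupAlgebra θ)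
    (l m : L) : (tensorEval (action L hθ hι) l m t : N) =
      ∑ x, ∑ y, tensorCoeff θ t (x, y) * (restrictHom L ι x l * restrictHom L ι y m) := by
  induction t with
  | zero => simp
  | add s t hs ht =>
    simp only [map_add, Pi.add_apply, add_mul, Finset.sum_add_distrib, ← hs, ← ht,
      IntermediateField.coe_add]
  | tmul a b =>
    simp only [tensorEval_tmul, IntermediateField.coe_mul, action_apply, mulTensor_tmul,
      Finset.sum_mul_sum]
    exact Finset.sum_congr rfl fun x _ => Finset.sum_congr rfl fun y _ => mul_mul_mul_comm _ _ _ _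

theorem jMap_action [Fintype Γ] (t : TwistedGroupAlgebra θ ⊗[K] L) (m : L) :
    (jMap (action L hθ hι) (TensorProduct.comm K _ _ t) m : N) =
      ∑ x, lTensorCoeff L θ t (x, ()) * restrictHom L ι x m := by
  induction t with
  | zero => simp
  | add s t hs ht =>
    simp only [map_add, Pi.add_apply, add_mul, Finset.sum_add_distrib, ← hs, ← ht,
      LinearMap.add_apply, IntermediateField.coe_add]
  | tmul a l =>
    rw [TensorProduct.comm_tmul, jMap_tmul, IntermediateField.coe_mul, action_apply,
      Finset.mul_sum]
    refine Finset.sum_congr rfl fun x _ => ?_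
    rw [mulTensor_tmul, LinearMap.pi_apply, mul_assoc, mul_left_comm]
    rfl

theorem injective_jMap_action (hinj : Function.Injective (restrictHom L ι)) :
    Function.Injective (jMap (action L hθ hι)) := by
  have := Fintype.ofFinite Γ
  rw [injective_iff_map_eq_zero]
  intro s hs
  obtain ⟨t, rfl⟩ := (TensorProduct.comm K (TwistedGroupAlgebra θ) L).surjective s
  have hcoeff : ∀ x, lTensorCoeff L θ t (x, ()) = 0 := by
    refine Fintype.linearIndependent_iff.1 (linearIndependent_restrictHom (L := L) (ι := ι) hinj)
      (fun x => lTensorCoeff L θ t (x, ())) ?_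
    ext m
    have hjm := jMap_action L hθ hι t m
    rw [hs] at hjm
    simpa only [LinearMap.sum_apply, LinearMap.smul_apply, AlgHom.toLinearMap_apply, smul_eq_mul,
      LinearMap.zero_apply, ZeroMemClass.coe_zero] using hjm.symm
  have ht : t = 0 := injective_lTensorCoeff L (by
    rw [map_zero]
    exact funext fun z => hcoeff z.1)
  rw [ht, map_zero]

theorem isHopfGalois_action (hinj : Function.Injective (restrictHom L ι))
    (hcard : Module.finrank K L = Nat.card Γ) : IsHopfGalois (action L hθ hι) where
  finite := inferInstance
  cocomm := inferInstance
  map_one a := by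
    have := Fintype.ofFinite Γ
    refine Subtype.ext ?_
    rw [action_apply, counit_apply]
    refine Eq.trans ?_ (algebraMap_counit a).symm
    simp
  map_mul a l m := by
    classical
    have := Fintype.ofFinite Γ
    refine Subtype.ext (Eq.trans ?_ (tensorEval_action L hθ hι _ l m).symm)
    rw [action_apply, comul_apply]
    simp [tensorCoeff_comul]
  bijective := by
    have hjinj := injective_jMap_action L hθ hι hinj
    refine ⟨hjinj, (LinearMap.injective_iff_surjective_of_finrank_eq_finrank ?_).1 hjinj⟩
    rw [Module.finrank_tensorProduct, Module.finrank_linearMap, finrank_eq, hcard]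

end TwistedGroupAlgebra

end TwistedGroupAlgebraAction

/-! ### Uniqueness of the Hopf-Galois structure in prime degree -/

theorem perm_eq_one_of_pow_card_eq_one {α : Type*} [Finite α] (hα : (Nat.card α).Prime)
    {q : Equiv.Perm α} (hq : q ^ Nat.card α = 1) {a : α} (ha : q a = a) : q = 1 := by
  classical
  have := Fintype.ofFinite α
  refine orderOf_eq_one_iff.1 (((Nat.dvd_prime hα).1 (orderOf_dvd_of_pow_eq_one hq)).resolve_right
    fun horder => ?_)
  rw [Nat.card_eq_fintype_card] at hα horder
  have hcycle := Equiv.Perm.isCycle_of_prime_order'' hα horder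
  have hsupport := (Finset.card_eq_iff_eq_univ _).1 (hcycle.orderOf.symm.trans horder)
  exact Equiv.Perm.mem_support.1 (hsupport ▸ Finset.mem_univ a) ha

section Idempotents

variable {N A Γ : Type*} [CommRing N] [Ring A] [Module N A] [IsScalarTower N A A]
  [SMulCommClass N A A] {b : Module.Basis Γ N A}

theorem repr_mul_of_orthogonalIdempotents [Finite Γ] (hb : OrthogonalIdempotents b) (s t : A)
    (y : Γ) : b.repr (s * t) y = b.repr s y * b.repr t y := by
  classical
  have := Fintype.ofFinite Γ
  rw [← b.sum_repr s, ← b.sum_repr t]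
  simp only [Finset.sum_mul_sum, smul_mul_smul_comm, hb.mul_eq, map_sum, map_smul, smul_ite,
    smul_zero, Finset.sum_ite_eq, Finset.mem_univ, if_true, Module.Basis.repr_self,
    Finsupp.coe_finsetSum, Finset.sum_apply, Finsupp.smul_apply, Finsupp.single_apply,
    smul_eq_mul, mul_ite, mul_one, mul_zero, Finset.sum_ite_eq']

/-- The coordinates of the `f x` in `b` form a matrix with exactly one nonzero entry in each column,
and it is equal to `1`. -/
theorem exists_perm_of_completeOrthogonalIdempotents [Fintype Γ] [IsDomain N]
    (hb : CompleteOrthogonalIdempotents b) {f : Γ → A} (hf : CompleteOrthogonalIdempotents f)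
    (hf₀ : ∀ x, f x ≠ 0) : ∃ q : Equiv.Perm Γ, ∀ x, f (q x) = b x := by
  classical
  have hone (y : Γ) : ∑ x, b.repr (f x) y = 1 := by
    rw [← Finset.sum_apply', ← map_sum, hf.complete, ← hb.complete]
    simp [Finsupp.single_apply]
  have hmul (x x' y : Γ) :
      b.repr (f x) y * b.repr (f x') y = if x = x' then b.repr (f x) y else 0 := by
    rw [← repr_mul_of_orthogonalIdempotents hb.toOrthogonalIdempotents, hf.mul_eq]
    split_ifs <;> simp
  have hex (y : Γ) : ∃ x, b.repr (f x) y ≠ 0 := by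
    obtain ⟨x, -, hx⟩ := Finset.exists_ne_zero_of_sum_ne_zero ((hone y).trans_ne one_ne_zero)
    exact ⟨x, hx⟩
  choose q hq using hex
  have hrepr (x y : Γ) : b.repr (f x) y = if q y = x then 1 else 0 := by
    have hxq := hmul x (q y) y
    split_ifs with h
    · subst h
      exact mul_right_cancel₀ (hq y) (by simpa using hxq)
    · rw [if_neg (Ne.symm h)] at hxq
      exact (mul_eq_zero.1 hxq).resolve_right (hq y)
  have hsurj : Function.Surjective q := by
    intro x
    by_contra! hx
    exact hf₀ x (b.repr.map_eq_zero_iff.1 (Finsupp.ext fun y => by rw [hrepr, if_neg (hx y)]; rfl))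
  have hbij : Function.Bijective q := ⟨Finite.injective_iff_surjective.2 hsurj, hsurj⟩
  refine ⟨.ofBijective q hbij, fun x => b.repr.injective (Finsupp.ext fun y => ?_)⟩
  rw [Equiv.ofBijective_apply, hrepr, b.repr_self, Finsupp.single_apply]
  exact if_congr (hbij.1.eq_iff.trans eq_comm) rfl rfl

end Idempotents

/-- Postcomposition with a morphism of algebras `A → B`, as a ring homomorphism between the
convolution algebras of linear maps from a coalgebra `C` to `A` and to `B`. -/
def convPostcomp {R A B : Type*} (C : Type*) [CommSemiring R] [Semiring A] [Semiring B]
    [AddCommMonoid C] [Algebra R A] [Algebra R B] [Module R C] [Coalgebra R C] (g : A →ₐ[R] B) :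
    WithConv (C →ₗ[R] A) →+* WithConv (C →ₗ[R] B) where
  toFun f := WithConv.toConv (g.toLinearMap ∘ₗ f.ofConv)
  map_one' := by ext; simp
  map_mul' f f' := congrArg WithConv.toConv (LinearMap.algHom_comp_convMul_distrib g f f')
  map_zero' := by ext; simp
  map_add' f f' := by ext; simp

section ActionCoord

variable {K L N : Type*} [Field K] [Field L] [Field N] [Algebra K L] [Algebra K N]
  [FiniteDimensional K L] {Γ : Type*} [Finite Γ] {σ : Γ → L →ₐ[K] N}
  (hσ : Function.Injective σ) (hcard : Module.finrank K L = Nat.card Γ)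

/-- The basis of `Hom_K(L, N)` consisting of the embeddings of `L` in `N`. -/
def algHomBasis : Module.Basis Γ N (L →ₗ[K] N) :=
  letI := Fintype.ofFinite Γ
  haveI : Nonempty Γ := (Nat.card_pos_iff.1 (hcard ▸ Module.finrank_pos)).1
  basisOfLinearIndependentOfCardEqFinrank ((linearIndependent_toLinearMap K L N).comp _ hσ)
    (by rw [Module.finrank_linearMap_self, hcard, Nat.card_eq_fintype_card])

theorem algHomBasis_apply (x : Γ) : algHomBasis hσ hcard x = (σ x).toLinearMap := by
  simp [algHomBasis]

theorem sum_repr_algHomBasis_mul [Fintype Γ] (f : L →ₗ[K] N) (l : L) :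
    ∑ x, (algHomBasis hσ hcard).repr f x * σ x l = f l := by
  conv_rhs => rw [← (algHomBasis hσ hcard).sum_repr f]
  simp [LinearMap.sum_apply, algHomBasis_apply]

include hσ hcard in
theorem eq_of_forall_sum_mul_eq [Fintype Γ] {c d : Γ → N}
    (h : ∀ l, ∑ x, c x * σ x l = ∑ x, d x * σ x l) : c = d := by
  refine (algHomBasis hσ hcard).linearIndependent.fintypeLinearCombination_injective
    (LinearMap.ext fun l => ?_)
  simpa [Fintype.linearCombination_apply, LinearMap.sum_apply, algHomBasis_apply] using h l

variable [Algebra L N] [IsScalarTower K L N] {H : Type*} [Ring H] [HopfAlgebra K H]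
  {ρ : HopfAction K L H}

/-- The coordinates of an action of `H` on `L`: the element `h` acts by `∑ₓ eₓ(h) σₓ`, where the
`σₓ` are the embeddings of `L` in `N`. -/
def actionCoord (ρ : HopfAction K L H) (x : Γ) : H →ₗ[K] N :=
  ((algHomBasis hσ hcard).coord x).restrictScalars K ∘ₗ
    LinearMap.compRight K (IsScalarTower.toAlgHom K L N).toLinearMap ∘ₗ ρ.toLinearMap

theorem sum_actionCoord_mul [Fintype Γ] (h : H) (l : L) :
    ∑ x, actionCoord hσ hcard ρ x h * σ x l = algebraMap L N (ρ h l) :=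
  sum_repr_algHomBasis_mul hσ hcard ((IsScalarTower.toAlgHom K L N).toLinearMap ∘ₗ ρ h) l

theorem actionCoord_eq_of_forall [Fintype Γ] {h : H} {c : Γ → N}
    (hc : ∀ l, ∑ x, c x * σ x l = algebraMap L N (ρ h l)) (x : Γ) :
    actionCoord hσ hcard ρ x h = c x :=
  congrFun (eq_of_forall_sum_mul_eq hσ hcard (c := fun x => actionCoord hσ hcard ρ x h)
    fun l => (sum_actionCoord_mul hσ hcard h l).trans (hc l).symm) x

theorem actionCoord_one [DecidableEq Γ] {x₀ : Γ} (hx₀ : σ x₀ = IsScalarTower.toAlgHom K L N)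
    (x : Γ) : actionCoord hσ hcard ρ x 1 = if x = x₀ then 1 else 0 := by
  have := Fintype.ofFinite Γ
  exact actionCoord_eq_of_forall (c := fun x => if x = x₀ then 1 else 0) hσ hcard
    (by simp [hx₀]) x

theorem actionCoord_perm_of_forall {g : N ≃ₐ[K] N}
    (hg : ∀ l : L, g (algebraMap L N l) = algebraMap L N l) {q : Equiv.Perm Γ}
    (hq : ∀ x l, g (σ x l) = σ (q x) l) (x : Γ) (h : H) :
    actionCoord hσ hcard ρ (q x) h = g (actionCoord hσ hcard ρ x h) := by
  have := Fintype.ofFinite Γ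
  refine (actionCoord_eq_of_forall (c := fun x => g (actionCoord hσ hcard ρ (q.symm x) h))
    hσ hcard (fun l => ?_) (q x)).trans (by rw [q.symm_apply_apply])
  rw [← hg, ← sum_actionCoord_mul hσ hcard, map_sum]
  refine (Fintype.sum_equiv q _ _ fun x => ?_).symm
  rw [map_mul, hq, q.symm_apply_apply]

theorem sum_sum_actionCoord_mul [Fintype Γ] (t : H ⊗[K] H) (l m : L) :
    ∑ x, (∑ y, LinearMap.mul' K N (TensorProduct.map (actionCoord hσ hcard ρ x)
      (actionCoord hσ hcard ρ y) t) * σ y m) * σ x l = algebraMap L N (tensorEval ρ l m t) := by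
  induction t with
  | zero => simp
  | add s t hs ht => simp only [map_add, add_mul, Finset.sum_add_distrib, hs, ht]
  | tmul a b =>
    simp only [TensorProduct.map_tmul, LinearMap.mul'_apply, tensorEval_tmul, map_mul,
      ← sum_actionCoord_mul hσ hcard]
    rw [Finset.sum_mul_sum]
    simp only [Finset.sum_mul]
    exact Finset.sum_congr rfl fun x _ => Finset.sum_congr rfl fun y _ => by ring

theorem mul'_map_actionCoord_comul [DecidableEq Γ] (hρ : IsHopfGalois ρ) (h : H) (x y : Γ) :
    LinearMap.mul' K N (TensorProduct.map (actionCoord hσ hcard ρ x) (actionCoord hσ hcard ρ y)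
      (Coalgebra.comul (R := K) h)) = if x = y then actionCoord hσ hcard ρ x h else 0 := by
  have := Fintype.ofFinite Γ
  refine congrFun (eq_of_forall_sum_mul_eq hσ hcard (c := fun y => LinearMap.mul' K N
    (TensorProduct.map (actionCoord hσ hcard ρ x) (actionCoord hσ hcard ρ y)
      (Coalgebra.comul (R := K) h)))
    (d := fun y => if x = y then actionCoord hσ hcard ρ x h else 0) fun m => ?_) y
  refine congrFun (eq_of_forall_sum_mul_eq hσ hcard (c := fun x => ∑ y, LinearMap.mul' K N
    (TensorProduct.map (actionCoord hσ hcard ρ x) (actionCoord hσ hcard ρ y)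
      (Coalgebra.comul (R := K) h)) * σ y m)
    (d := fun x => ∑ y, (if x = y then actionCoord hσ hcard ρ x h else 0) * σ y m)
    fun l => ?_) x
  rw [sum_sum_actionCoord_mul, ← hρ.apply_mul, ← sum_actionCoord_mul hσ hcard]
  refine Finset.sum_congr rfl fun x _ => ?_
  simp [mul_assoc, mul_comm (σ x m)]

theorem completeOrthogonalIdempotents_actionCoord [Fintype Γ] (hρ : IsHopfGalois ρ) :
    CompleteOrthogonalIdempotents fun x => WithConv.toConv (actionCoord hσ hcard ρ x) where
  toOrthogonalIdempotents := by
    classical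
    refine OrthogonalIdempotents.iff_mul_eq.2 fun x y => WithConv.ext (LinearMap.ext fun h => ?_)
    refine (mul'_map_actionCoord_comul hσ hcard hρ h x y).trans ?_
    split_ifs <;> rfl
  complete := by
    refine WithConv.ext (LinearMap.ext fun h => ?_)
    have hsum := sum_actionCoord_mul hσ hcard (ρ := ρ) h 1
    rw [hρ.map_one, ← IsScalarTower.algebraMap_apply] at hsum
    simpa only [map_one, mul_one, WithConv.ofConv_sum, LinearMap.sum_apply] using! hsum

theorem span_comp_action_eq_top (hρ : IsHopfGalois ρ) :
    Submodule.span N (Set.range fun h =>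
      (IsScalarTower.toAlgHom K L N).toLinearMap ∘ₗ ρ h) = ⊤ := by
  set S := Submodule.span N (Set.range fun h => (IsScalarTower.toAlgHom K L N).toLinearMap ∘ₗ ρ h)
  have hend (f : Module.End K L) : (IsScalarTower.toAlgHom K L N).toLinearMap ∘ₗ f ∈ S := by
    obtain ⟨t, rfl⟩ := hρ.bijective.2 f
    induction t with
    | zero => simp
    | add s t hs ht => simpa only [map_add, LinearMap.comp_add] using add_mem hs ht
    | tmul x h =>
      convert S.smul_mem (algebraMap L N x) (Submodule.subset_span ⟨h, rfl⟩) using 1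
      ext l
      simp [jMap_tmul, Algebra.smul_def]
  refine eq_top_iff.2 fun f _ => ?_
  let b := Module.finBasis K L
  have hf : f = ∑ i, f (b i) •
      ((IsScalarTower.toAlgHom K L N).toLinearMap ∘ₗ (b.coord i).smulRight 1) :=
    b.ext fun j => by simp [LinearMap.sum_apply, Finsupp.single_apply]
  rw [hf]
  exact Submodule.sum_mem _ fun i _ => S.smul_mem _ (hend _)

theorem linearIndependent_actionCoord (hρ : IsHopfGalois ρ) :
    LinearIndependent N (actionCoord hσ hcard ρ) := by
  have := Fintype.ofFinite Γ
  refine Fintype.linearIndependent_iff.2 fun c hc x => ?_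
  let b := algHomBasis hσ hcard
  have hzero : ∑ x, c x • b.coord x = 0 := by
    refine LinearMap.ext_on_range (span_comp_action_eq_top hρ) fun h => ?_
    simpa [LinearMap.sum_apply] using! DFunLike.congr_fun hc h
  classical
  simpa [LinearMap.sum_apply, Finsupp.single_apply] using DFunLike.congr_fun hzero (b x)

/-- The coordinates of a Hopf-Galois structure form a basis of the convolution algebra. -/
def actionCoordBasis (hρ : IsHopfGalois ρ) : Module.Basis Γ N (WithConv (H →ₗ[K] N)) :=
  letI := Fintype.ofFinite Γ
  haveI : Nonempty Γ := (Nat.card_pos_iff.1 (hcard ▸ Module.finrank_pos)).1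
  haveI := hρ.finite
  (basisOfLinearIndependentOfCardEqFinrank (linearIndependent_actionCoord hσ hcard hρ)
    (by rw [Module.finrank_linearMap_self, hρ.finrank_eq, hcard, Nat.card_eq_fintype_card])).map
    (WithConv.linearEquiv N (H →ₗ[K] N)).symm

theorem actionCoordBasis_apply (hρ : IsHopfGalois ρ) (x : Γ) :
    actionCoordBasis hσ hcard hρ x = WithConv.toConv (actionCoord hσ hcard ρ x) := by
  simp [actionCoordBasis]

theorem injective_actionCoord (hρ : IsHopfGalois ρ) :
    Function.Injective (actionCoord hσ hcard ρ) :=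
  (linearIndependent_actionCoord hσ hcard hρ).injective

/-- Both the `eₓ` and their images under `g` are complete families of orthogonal idempotents of the
convolution algebra. -/
theorem exists_perm_apply_actionCoord (hρ : IsHopfGalois ρ) (g : N ≃ₐ[K] N) :
    ∃ q : Equiv.Perm Γ, ∀ x h,
      g (actionCoord hσ hcard ρ (q x) h) = actionCoord hσ hcard ρ x h := by
  have := Fintype.ofFinite Γ
  have he := completeOrthogonalIdempotents_actionCoord hσ hcard hρ
  have hne (x : Γ) : convPostcomp H (g : N →ₐ[K] N) (.toConv (actionCoord hσ hcard ρ x)) ≠ 0 :=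
    fun hx => (linearIndependent_actionCoord hσ hcard hρ).ne_zero x (LinearMap.ext fun h =>
      g.injective ((DFunLike.congr_fun (congrArg WithConv.ofConv hx) h).trans (map_zero g).symm))
  obtain ⟨q, hq⟩ := exists_perm_of_completeOrthogonalIdempotents (b := actionCoordBasis hσ hcard hρ)
    (by simpa only [funext (actionCoordBasis_apply hσ hcard hρ)] using he)
    (he.map (convPostcomp H (g : N →ₐ[K] N))) hne
  exact ⟨q, fun x h => DFunLike.congr_fun (congrArg WithConv.ofConv
    ((hq x).trans (actionCoordBasis_apply hσ hcard hρ x))) h⟩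

theorem apply_actionCoord_of_pow_card_eq_one (hρ : IsHopfGalois ρ) (hΓ : (Nat.card Γ).Prime)
    {x₀ : Γ} (hx₀ : σ x₀ = IsScalarTower.toAlgHom K L N) {g : N ≃ₐ[K] N}
    (hg : g ^ Nat.card Γ = 1) (x : Γ) (h : H) :
    g (actionCoord hσ hcard ρ x h) = actionCoord hσ hcard ρ x h := by
  classical
  obtain ⟨q, hq⟩ := exists_perm_apply_actionCoord hσ hcard hρ g
  have hpow (n : ℕ) (x : Γ) (h : H) :
      (g ^ n) (actionCoord hσ hcard ρ ((q ^ n) x) h) = actionCoord hσ hcard ρ x h := by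
    induction n generalizing x with
    | zero => simp
    | succ n ih => rw [pow_succ, pow_succ', AlgEquiv.mul_apply, Equiv.Perm.mul_apply, hq, ih]
  have hqpow : q ^ Nat.card Γ = 1 := Equiv.ext fun x =>
    injective_actionCoord hσ hcard hρ (LinearMap.ext fun h => by
      simpa [hg] using hpow (Nat.card Γ) x h)
  have hqx₀ : q x₀ = x₀ := by
    by_contra hne
    simpa [actionCoord_one hσ hcard hx₀, hne] using hq x₀ 1
  simpa [perm_eq_one_of_pow_card_eq_one hΓ hqpow hqx₀] using hq x h

end ActionCoord

section Uniqueness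

variable {K N Γ : Type*} [Field K] [Field N] [Algebra K N] [FiniteDimensional K N]
  {L : IntermediateField K N} [Group Γ] [IsMulCommutative Γ] [Finite Γ]
  {θ : (N ≃ₐ[K] N) →* MulAut Γ} {ι : Γ →* N ≃ₐ[K] N}
  {H : Type*} [Ring H] [HopfAlgebra K H] {ρ : HopfAction K L H}
  (hθ : ∀ g x, ι (θ g x) = g * ι x * g⁻¹) (hι : Function.Injective ι)
  (hinj : Function.Injective (restrictHom L ι)) (hcard : Module.finrank K L = Nat.card Γ)
  (hG : ∀ g : N ≃ₐ[K] N, ∃ x, ∃ k ∈ L.fixingSubgroup, g = ι x * k)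

include hθ hι hG in
theorem actionCoord_apply_eq (hρ : IsHopfGalois ρ) (hΓ : (Nat.card Γ).Prime) (g : N ≃ₐ[K] N)
    (x : Γ) (h : H) :
    actionCoord hinj hcard ρ (θ g x) h = g (actionCoord hinj hcard ρ x h) := by
  obtain ⟨z, k, hk, rfl⟩ := hG g
  have hzpow : ι z ^ Nat.card Γ = 1 := by rw [← map_pow, pow_card_eq_one', map_one]
  have hkx : actionCoord hinj hcard ρ (θ k x) h = k (actionCoord hinj hcard ρ x h) :=
    actionCoord_perm_of_forall hinj hcard (q := (θ k).toEquiv)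
      (fun l => (IntermediateField.mem_fixingSubgroup_iff L k).1 hk l l.2)
      (fun x l => apply_restrictHom_of_mem_fixingSubgroup hθ hk x l) x h
  have hone : restrictHom L ι 1 = IsScalarTower.toAlgHom K L N :=
    AlgHom.ext fun l => by rw [restrictHom_apply, map_one]; rfl
  rw [AlgEquiv.mul_apply, map_mul, MulAut.mul_apply, conj_apply_eq_self hθ hι, ← hkx,
    apply_actionCoord_of_pow_card_eq_one hinj hcard hρ hΓ hone hzpow]

include hinj hcard hG in
theorem range_eq_range_action [IsGalois K N] (hρ : IsHopfGalois ρ) (hΓ : (Nat.card Γ).Prime) :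
    ρ.range = (TwistedGroupAlgebra.action L hθ hι).range := by
  have := Fintype.ofFinite Γ
  have hρ₀ := TwistedGroupAlgebra.isHopfGalois_action L hθ hι hinj hcard
  have hle : ρ.range ≤ (TwistedGroupAlgebra.action L hθ hι).range := by
    rintro _ ⟨a, rfl⟩
    refine ⟨.ofCoeff (fun x => actionCoord hinj hcard ρ x a)
      fun g x => actionCoord_apply_eq hθ hι hinj hcard hG hρ hΓ g x a, ?_⟩
    ext l
    exact (TwistedGroupAlgebra.action_apply L hθ hι _ l).trans
      (sum_actionCoord_mul hinj hcard a l)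
  refine Subalgebra.toSubmodule_injective (Submodule.eq_of_le_of_finrank_eq hle ?_)
  exact (LinearMap.finrank_range_of_inj (f := ρ.toLinearMap) hρ.injective).trans
    ((hρ.finrank_eq.trans hρ₀.finrank_eq.symm).trans
      (LinearMap.finrank_range_of_inj
        (f := (TwistedGroupAlgebra.action L hθ hι).toLinearMap) hρ₀.injective).symm)

end Uniqueness

section NormalComplement

variable {K N : Type*} [Field K] [Field N] [Algebra K N] [FiniteDimensional K N]
  [IsGalois K N] {L : IntermediateField K N} {J : Subgroup (N ≃ₐ[K] N)}

omit [FiniteDimensional K N] [IsGalois K N] in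
theorem injective_restrictHom_subtype (hJ : Disjoint J L.fixingSubgroup) :
    Function.Injective (restrictHom L J.subtype) := by
  intro x y h
  have hmem : x.1⁻¹ * y.1 ∈ L.fixingSubgroup := by
    refine (IntermediateField.mem_fixingSubgroup_iff L _).2 fun l hl => ?_
    have hl' : x.1 l = y.1 l := DFunLike.congr_fun h ⟨l, hl⟩
    rw [AlgEquiv.mul_apply, ← hl', ← AlgEquiv.mul_apply, inv_mul_cancel, AlgEquiv.one_apply]
  exact Subtype.ext (inv_mul_eq_one.1
    (Subgroup.disjoint_def.1 hJ (J.mul_mem (J.inv_mem x.2) y.2) hmem))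

variable [J.Normal] [IsMulCommutative J] (hJ : Subgroup.IsComplement' J L.fixingSubgroup)

include hJ in
theorem isHopfGaloisExtension_of_isComplement' : IsHopfGaloisExtension K L :=
  ⟨_, inferInstance, inferInstance, _,
    TwistedGroupAlgebra.isHopfGalois_action L (ι := J.subtype) (θ := MulAut.conjNormal)
      (fun g x => MulAut.conjNormal_apply g x) Subtype.val_injective
      (injective_restrictHom_subtype hJ.disjoint) (finrank_eq_card_of_isComplement' hJ)⟩

variable {H : Type*} [Ring H] [HopfAlgebra K H] {ρ : HopfAction K L H}

variable (L J) in
/-- The image in `End_K(L)` of the Hopf algebra `N[J]^G`, where `G = Gal(N/K)` acts on its normal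
subgroup `J` by conjugation. -/
def complementRange : Subalgebra K (Module.End K L) :=
  (TwistedGroupAlgebra.action L (ι := J.subtype) (θ := MulAut.conjNormal)
    (fun g x => MulAut.conjNormal_apply g x) Subtype.val_injective).range

theorem mul_comm_of_mem_complementRange {a b : Module.End K L} (ha : a ∈ complementRange L J)
    (hb : b ∈ complementRange L J) : a * b = b * a := by
  obtain ⟨a, rfl⟩ := ha
  obtain ⟨b, rfl⟩ := hb
  exact Commute.map (TwistedGroupAlgebra.mul_comm a b) _

include hJ in
theorem IsHopfGalois.range_eq_complementRange (hρ : IsHopfGalois ρ) (hcard : (Nat.card J).Prime) :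
    ρ.range = complementRange L J := by
  refine range_eq_range_action (ι := J.subtype) (θ := MulAut.conjNormal)
    (fun g x => MulAut.conjNormal_apply g x) Subtype.val_injective
    (injective_restrictHom_subtype hJ.disjoint) (finrank_eq_card_of_isComplement' hJ)
    (fun g => ?_) hρ hcard
  obtain ⟨⟨x, k⟩, rfl⟩ := hJ.2 g
  exact ⟨x, k, k.2, rfl⟩

include hJ in
theorem IsHopfGalois.mul_comm (hρ : IsHopfGalois ρ) (hcard : (Nat.card J).Prime) (a b : H) :
    a * b = b * a := by
  refine hρ.injective ?_
  rw [_root_.map_mul, _root_.map_mul]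
  exact mul_comm_of_mem_complementRange (hρ.range_eq_complementRange hJ hcard ▸ ρ.mem_range_self a)
    (hρ.range_eq_complementRange hJ hcard ▸ ρ.mem_range_self b)

include hJ in
theorem IsHopfGalois.isUniqueHopfGalois (hρ : IsHopfGalois ρ) (hcard : (Nat.card J).Prime) :
    IsUniqueHopfGalois.{z} ρ :=
  ⟨hρ, fun _ _ _ _ hρ₁ => exists_bialgEquiv_of_range_eq hρ₁ hρ
    ((hρ₁.range_eq_complementRange hJ hcard).trans (hρ.range_eq_complementRange hJ hcard).symm)⟩

end NormalComplement

section BaseChangeAction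

variable {K K' L L' : Type*} [Field K] [Field K'] [Field L] [Field L'] [Algebra K K'] [Algebra K L]
  [Algebra K L'] [Algebra K' L'] [Algebra L L'] [IsScalarTower K K' L'] [IsScalarTower K L L']
  [Algebra.IsPushout K K' L L'] {H : Type*} [Ring H] [HopfAlgebra K H]

variable (K' L') in
/-- The action of `K' ⊗ H` on `L' = K' ⊗ L` obtained by base change from an action of `H` on `L`. -/
def baseChangeAction (ρ : HopfAction K L H) : HopfAction K' L' (K' ⊗[K] H) :=
  ((Algebra.IsPushout.equiv K K' L L').toLinearEquiv.conjAlgEquiv K').toAlgHom.comp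
    (Algebra.TensorProduct.lift (Algebra.ofId K' (Module.End K' (K' ⊗[K] L)))
      ((Module.End.baseChangeHom K K' L).comp ρ) fun a _ => Algebra.commute_algebraMap_left a _)

@[simp]
theorem baseChangeAction_tmul_algebraMap (ρ : HopfAction K L H) (a : K') (h : H) (x : L) :
    baseChangeAction K' L' ρ (a ⊗ₜ h) (algebraMap L L' x) = a • algebraMap L L' (ρ h x) := by
  change Algebra.IsPushout.equiv K K' L L' (a • ((ρ h).baseChange K'
    ((Algebra.IsPushout.equiv K K' L L').symm (algebraMap L L' x)))) = _
  simp [Algebra.IsPushout.equiv_symm_algebraMap_right, Algebra.IsPushout.equiv_tmul]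

variable (K K' L) in
include K in
@[elab_as_elim]
theorem induction_of_isPushout {motive : L' → Prop} (zero : motive 0)
    (add : ∀ x y, motive x → motive y → motive (x + y))
    (smul : ∀ (a : K') (x : L), motive (a • algebraMap L L' x)) (y : L') : motive y := by
  obtain ⟨t, rfl⟩ := (Algebra.IsPushout.equiv K K' L L').surjective y
  induction t with
  | zero => rwa [map_zero]
  | add s t hs ht => rw [map_add]; exact add _ _ hs ht
  | tmul a x => rw [Algebra.IsPushout.equiv_tmul, ← Algebra.smul_def]; exact smul a x

variable (K) in
include K in
theorem linearMap_ext_of_isPushout {V : Type*} [AddCommMonoid V] [Module K' V] {f g : L' →ₗ[K'] V}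
    (hfg : ∀ x : L, f (algebraMap L L' x) = g (algebraMap L L' x)) : f = g :=
  letI := Module.compHom V (algebraMap K K')
  haveI : IsScalarTower K K' V := .of_algebraMap_smul fun _ _ => rfl
  (Algebra.IsPushout.out : IsBaseChange K' (IsScalarTower.toAlgHom K L L').toLinearMap).algHom_ext
    f g hfg

theorem eq_baseChangeAction {ρ : HopfAction K L H} {σ : HopfAction K' L' (K' ⊗[K] H)}
    (hσ : ∀ a h (x : L), σ (a ⊗ₜ h) (algebraMap L L' x) = a • algebraMap L L' (ρ h x)) :
    σ = baseChangeAction K' L' ρ := by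
  refine AlgHom.ext fun t => linearMap_ext_of_isPushout K (L := L) fun x => ?_
  induction t with
  | zero => simp
  | add s t hs ht => simp only [map_add, LinearMap.add_apply, hs, ht]
  | tmul a h => rw [hσ, baseChangeAction_tmul_algebraMap]

theorem tensorEval_baseChangeAction (ρ : HopfAction K L H) (a b c : K') (t : H ⊗[K] H) (x y : L) :
    tensorEval (baseChangeAction K' L' ρ) (b • algebraMap L L' x) (c • algebraMap L L' y)
      (TensorProduct.AlgebraTensorModule.tensorTensorTensorComm K K' K K' K' K' H H
        ((1 ⊗ₜ a) ⊗ₜ t)) = (a * b * c) • algebraMap L L' (tensorEval ρ x y t) := by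
  induction t with
  | zero => simp
  | add s t hs ht => simp only [TensorProduct.tmul_add, map_add, hs, ht, smul_add]
  | tmul h k =>
    simp only [TensorProduct.AlgebraTensorModule.tensorTensorTensorComm_tmul, tensorEval_tmul,
      map_smul, baseChangeAction_tmul_algebraMap, map_mul, one_smul, smul_mul_smul_comm, smul_smul]
    ring_nf

theorem baseChangeAction_apply_one {ρ : HopfAction K L H} (hρ : IsHopfGalois ρ) (t : K' ⊗[K] H) :
    baseChangeAction K' L' ρ t 1 = algebraMap K' L' (Coalgebra.counit (R := K') t) := by
  induction t with
  | zero => simp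
  | add s t hs ht => simp only [map_add, LinearMap.add_apply, hs, ht]
  | tmul a h =>
    rw [← map_one (algebraMap L L'), baseChangeAction_tmul_algebraMap, hρ.map_one,
      TensorProduct.counit_tmul, CommSemiring.counit_apply, Algebra.smul_def, Algebra.smul_def,
      map_mul, ← IsScalarTower.algebraMap_apply, ← IsScalarTower.algebraMap_apply, mul_comm]

theorem baseChangeAction_apply_mul {ρ : HopfAction K L H} (hρ : IsHopfGalois ρ) (t : K' ⊗[K] H)
    (x y : L') :
    baseChangeAction K' L' ρ t (x * y) =
      tensorEval (baseChangeAction K' L' ρ) x y (Coalgebra.comul (R := K') t) := by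
  induction t with
  | zero => simp
  | add s t hs ht => simp only [map_add, LinearMap.add_apply, hs, ht]
  | tmul a h =>
    refine induction_of_isPushout K K' L (by simp [tensorEval]) (fun x x' hx hx' => ?_)
      (fun b x => ?_) x
    · rw [add_mul, map_add, hx, hx']
      simp [tensorEval, TensorProduct.map_add_left]
    refine induction_of_isPushout K K' L (by simp [tensorEval]) (fun y y' hy hy' => ?_)
      (fun c y => ?_) y
    · rw [mul_add, map_add, hy, hy']
      simp [tensorEval, TensorProduct.map_add_right]
    rw [TensorProduct.comul_tmul, CommSemiring.comul_apply, tensorEval_baseChangeAction,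
      ← hρ.apply_mul, smul_mul_smul_comm, ← map_mul, map_smul,
      baseChangeAction_tmul_algebraMap, smul_smul]
    ring_nf

theorem IsHopfGalois.surjective_jMap_baseChangeAction [FiniteDimensional K L]
    {ρ : HopfAction K L H} (hρ : IsHopfGalois ρ) :
    Function.Surjective (jMap (baseChangeAction K' L' ρ)) := by
  intro f
  suffices ∀ g : L →ₗ[K] L', ∃ t, ∀ x,
      jMap (baseChangeAction K' L' ρ) t (algebraMap L L' x) = g x by
    obtain ⟨t, ht⟩ := this
      (f.restrictScalars K ∘ₗ (IsScalarTower.toAlgHom K L L').toLinearMap)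
    exact ⟨t, linearMap_ext_of_isPushout K ht⟩
  intro g
  have hg : g ∈ Submodule.span L' _ := span_comp_action_eq_top (N := L') hρ ▸ Submodule.mem_top
  induction hg using Submodule.span_induction with
  | mem _ hg =>
    obtain ⟨h, rfl⟩ := hg
    exact ⟨1 ⊗ₜ (1 ⊗ₜ h), fun x => by simp [jMap_tmul]⟩
  | zero => exact ⟨0, by simp⟩
  | add g g' _ _ hg hg' =>
    obtain ⟨⟨t, ht⟩, t', ht'⟩ := And.intro hg hg'
    exact ⟨t + t', fun x => by simp [ht, ht']⟩
  | smul y g _ hg =>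
    obtain ⟨t, ht⟩ := hg
    refine ⟨y • t, fun x => ?_⟩
    rw [LinearMap.smul_apply, ← ht]
    clear ht
    induction t with
    | zero => simp
    | add s t hs ht => simp only [smul_add, map_add, LinearMap.add_apply, hs, ht]
    | tmul l s => simp [TensorProduct.smul_tmul', jMap_tmul, mul_assoc]

theorem IsHopfGalois.baseChangeAction [FiniteDimensional K L] {ρ : HopfAction K L H}
    (hρ : IsHopfGalois ρ) : IsHopfGalois (baseChangeAction K' L' ρ) where
  finite := have := hρ.finite; inferInstance
  cocomm := have := hρ.cocomm; inferInstance
  map_one := baseChangeAction_apply_one hρ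
  map_mul := baseChangeAction_apply_mul hρ
  bijective := by
    have := hρ.finite
    let e := (Algebra.IsPushout.equiv K K' L L').toLinearEquiv
    have : FiniteDimensional K' L' := .equiv e
    have hsurj := hρ.surjective_jMap_baseChangeAction (K' := K') (L' := L')
    refine ⟨(LinearMap.injective_iff_surjective_of_finrank_eq_finrank ?_).2 hsurj, hsurj⟩
    rw [Module.finrank_tensorProduct, Module.finrank_linearMap, Module.finrank_baseChange,
      hρ.finrank_eq, ← e.finrank_eq, Module.finrank_baseChange]

end BaseChangeAction

section Freeness

theorem isBaseChange_iff_bijective_sum_smul {R S M N κ : Type*} [CommSemiring R] [CommSemiring S]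
    [Algebra R S] [AddCommMonoid M] [AddCommMonoid N] [Module R M] [Module R N] [Module S N]
    [IsScalarTower R S N] [Fintype κ] (b : Module.Basis κ R S) (f : M →ₗ[R] N) :
    IsBaseChange S f ↔ Function.Bijective fun m : κ → M => ∑ k, b k • f (m k) := by
  classical
  let e : (κ → M) ≃ S ⊗[R] M :=
    Finsupp.equivFunOnFinite.symm.trans (TensorProduct.equivFinsuppOfBasisLeft b).symm.toEquiv
  have he : (fun m : κ → M => ∑ k, b k • f (m k)) = f.liftBaseChange S ∘ e := by
    ext m
    simp [e, Finsupp.sum_fintype]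
  rw [he, e.bijective.of_comp_iff]
  rw [IsBaseChange, IsTensorProduct]
  exact iff_of_eq (congrArg Function.Bijective (funext fun t => by rfl))

theorem isBaseChange_of_isPushout {A B R R' M M' : Type*} [CommRing A] [CommRing B] [CommRing R]
    [CommRing R'] [Algebra A B] [Algebra A R] [Algebra A R'] [Algebra B R'] [Algebra R R']
    [IsScalarTower A B R'] [IsScalarTower A R R'] [Algebra.IsPushout A B R R']
    [AddCommGroup M] [AddCommGroup M'] [Module A M] [Module R M] [IsScalarTower A R M]
    [Module A M'] [Module B M'] [Module R M'] [Module R' M'] [IsScalarTower A B M']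
    [IsScalarTower A R M'] [IsScalarTower B R' M'] [IsScalarTower R R' M']
    {f : M →ₗ[R] M'} (hf : IsBaseChange B (f.restrictScalars A)) : IsBaseChange R' f := by
  let e : R' ⊗[R] M ≃ₗ[B] M' :=
    Algebra.IsPushout.cancelBaseChange A B R R' M ≪≫ₗ hf.equiv
  have he : ⇑(f.liftBaseChange R') = e := by
    suffices (f.liftBaseChange R').restrictScalars B ∘ₗ
        (Algebra.IsPushout.cancelBaseChange A B R R' M).symm.toLinearMap = hf.equiv.toLinearMap by
      funext t
      obtain ⟨s, rfl⟩ := (Algebra.IsPushout.cancelBaseChange A B R R' M).symm.surjective t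
      simpa [e] using LinearMap.congr_fun this s
    ext m
    simp [hf.equiv_tmul]
  rw [IsBaseChange, IsTensorProduct]
  convert e.bijective
  exact he

theorem finite_maximalSpectrum_of_finite (A S : Type*) [CommRing A] [IsLocalRing A] [CommRing S]
    [Algebra A S] [Module.Finite A S] : Finite (MaximalSpectrum S) := by
  have := (Algebra.QuasiFinite.finite_primesOver (S := S) (IsLocalRing.maximalIdeal A)).to_subtype
  refine Finite.of_injective (β := (IsLocalRing.maximalIdeal A).primesOver S)
    (fun P => ⟨P.1, P.2.isPrime, ⟨?_⟩⟩) fun P Q h => MaximalSpectrum.ext (congrArg Subtype.val h)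
  have := P.2
  exact (IsLocalRing.eq_maximalIdeal
    (Ideal.isMaximal_comap_of_isIntegral_of_isMaximal (R := A) P.1)).symm

theorem free_of_free_pi {R M : Type*} [CommRing R] [Finite (MaximalSpectrum R)] [AddCommGroup M]
    [Module R M] [Module.Finite R M] {κ : Type*} [Finite κ] [Nonempty κ]
    (h : Module.Free R (κ → M)) : Module.Free R M := by
  classical
  have := Fintype.ofFinite κ
  obtain ⟨k⟩ := ‹Nonempty κ›
  have : Module.Projective R M := Module.Projective.of_split (LinearMap.single R (fun _ => M) k)
    (LinearMap.proj k) (by ext; simp)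
  refine Module.free_of_flat_of_finrank_eq R M
    (Module.finrank R (κ → M) / Fintype.card κ) fun P => ?_
  have hP := P.2
  let _ := Ideal.Quotient.field P.1
  have : Nontrivial R := (Ideal.Quotient.mk P.1).domain_nontrivial
  rw [← Module.finrank_baseChange (R := R ⧸ P.1) (M' := κ → M),
    (TensorProduct.piRight R (R ⧸ P.1) (R ⧸ P.1) fun _ : κ => M).finrank_eq,
    Module.finrank_pi_fintype, Finset.sum_const, smul_eq_mul, Finset.card_univ,
    Nat.mul_div_cancel_left _ Fintype.card_pos]

theorem free_iff_free_of_isBaseChange {R R' M M' : Type*} [CommRing R] [CommRing R'] [Nontrivial R']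
    [Algebra R R'] [Module.Free R R'] [Module.Finite R R'] [AddCommGroup M] [AddCommGroup M']
    [Module R M] [Module R M'] [Module R' M'] [IsScalarTower R R' M'] [Finite (MaximalSpectrum R)]
    [Module.Finite R M] {f : M →ₗ[R] M'} (hf : IsBaseChange R' f) :
    Module.Free R' M' ↔ Module.Free R M := by
  classical
  refine ⟨fun _ => ?_, fun _ => hf.free⟩
  have : Module.Free R M' := .trans (S := R')
  have b := Module.Free.chooseBasis R R'
  have := b.index_nonempty
  exact free_of_free_pi (.of_equiv ((hf.equiv.restrictScalars R).symm ≪≫ₗ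
    TensorProduct.equivFinsuppOfBasisLeft b ≪≫ₗ Finsupp.linearEquivFunOnFinite R M _))

theorem free_iff_free_of_isBaseChange_semilinear {A B R R' M M' : Type*} [CommRing A]
    [IsLocalRing A] [CommRing B] [Ring R] [Ring R'] [Nontrivial R'] [Algebra A B] [Algebra A R]
    [Algebra A R'] [Algebra B R'] [IsScalarTower A B R'] [Module.Free A B] [Module.Finite A B]
    [Module.Finite A R] [AddCommGroup M] [AddCommGroup M'] [Module A M] [Module R M]
    [IsScalarTower A R M] [Module.Finite A M] [Module A M'] [Module B M'] [Module R' M']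
    [IsScalarTower A B M'] [IsScalarTower B R' M'] {φ : R →ₐ[A] R'} {ψ : M →ₗ[A] M'}
    (hR : ∀ r s : R, r * s = s * r) (hR' : ∀ r s : R', r * s = s * r)
    (hφ : IsBaseChange B φ.toLinearMap) (hψ : IsBaseChange B ψ)
    (hφψ : ∀ r m, ψ (r • m) = φ r • ψ m) : Module.Free R' M' ↔ Module.Free R M := by
  let _ : CommRing R := { ‹Ring R› with mul_comm := hR }
  let _ : CommRing R' := { ‹Ring R'› with mul_comm := hR' }
  algebraize [φ.toRingHom]
  have : IsScalarTower A R R' := .of_algHom φ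
  have : Algebra.IsPushout A B R R' := ⟨hφ⟩
  let _ : Module R M' := .compHom M' (algebraMap R R')
  have : IsScalarTower R R' M' := .of_algebraMap_smul fun _ _ => rfl
  have : IsScalarTower A R' M' := .to₁₃₄ A B R' M'
  have : IsScalarTower A R M' := .to₁₂₄ A R R' M'
  have : Algebra.IsPushout A R B R' := .symm ‹_›
  have : Module.Free R R' := .of_equiv (Algebra.IsPushout.equiv A R B R').toLinearEquiv
  have : Module.Finite R R' := .equiv (Algebra.IsPushout.equiv A R B R').toLinearEquiv
  have : Finite (MaximalSpectrum R) := finite_maximalSpectrum_of_finite A R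
  have : Module.Finite R M := .of_restrictScalars_finite A R M
  let f : M →ₗ[R] M' := { ψ with map_smul' := hφψ }
  exact free_iff_free_of_isBaseChange
    (isBaseChange_of_isPushout (A := A) (B := B) (R' := R') (f := f) hψ)

end Freeness

section AssociatedOrder

variable (p : ℕ) [Fact p.Prime]

section Basis

variable (F E : Type*) [Field F] [Field E] [Algebra F E] [Algebra ℚ_[p] F] [Algebra ℚ_[p] E]
  [FiniteDimensional ℚ_[p] F] [FiniteDimensional ℚ_[p] E] [Algebra ℤ_[p] F] [Algebra ℤ_[p] E]
  [IsScalarTower ℤ_[p] ℚ_[p] F] [IsScalarTower ℤ_[p] ℚ_[p] E] [IsScalarTower ℤ_[p] F E]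

variable {F E} in
theorem exists_basis_eq_intRing_basis {κ : Type*} [Finite κ]
    (b : Module.Basis κ (intRing p F) (intRing p E)) :
    ∃ B : Module.Basis κ F E, ∀ k, B k = b k := by
  have := Fintype.ofFinite κ
  have hindep : LinearIndependent F fun k => (b k : E) := by
    rw [← LinearIndependent.iff_fractionRing (intRing p F) F]
    exact b.linearIndependent.map'
      (IsScalarTower.toAlgHom (intRing p F) (intRing p E) E).toLinearMap
      (LinearMap.ker_eq_bot.2 Subtype.val_injective)
  have hcard : Fintype.card κ = Module.finrank F E := by
    rw [← finrank_intRing p F E, Module.finrank_eq_card_basis b]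
  have := b.index_nonempty
  exact ⟨basisOfLinearIndependentOfCardEqFinrank hindep hcard, fun k => by simp⟩

end Basis

section Finite

attribute [local instance] associatedOrderModule

variable {p} {F E : Type*} [Field F] [Field E] [Algebra F E] [Algebra ℤ_[p] F] [Algebra ℤ_[p] E]
  [IsScalarTower ℤ_[p] F E] {H : Type*} [Ring H] [HopfAlgebra F H] {ρ : HopfAction F E H}

@[simp]
theorem coe_associatedOrder_smul (a : associatedOrder p ρ) (x : intRing p E) :
    ((a • x : intRing p E) : E) = ρ a x := rfl

instance isScalarTower_associatedOrder :
    IsScalarTower (intRing p F) (associatedOrder p ρ) (intRing p E) where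
  smul_assoc r a x := Subtype.ext <| by
    rw [coe_associatedOrder_smul, Algebra.smul_def r (a • x)]
    change ρ ((r : F) • (a : H)) x = algebraMap F E r * ρ a x
    rw [map_smul, LinearMap.smul_apply, Algebra.smul_def]

variable [Algebra ℚ_[p] F] [Algebra ℚ_[p] E] [FiniteDimensional ℚ_[p] F] [FiniteDimensional ℚ_[p] E]
  [IsScalarTower ℤ_[p] ℚ_[p] F] [IsScalarTower ℤ_[p] ℚ_[p] E]

theorem IsHopfGalois.faithfulSMul_associatedOrder (hρ : IsHopfGalois ρ) :
    FaithfulSMul (associatedOrder p ρ) (intRing p E) where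
  eq_of_smul_eq_smul {a c} h := by
    obtain ⟨B, hB⟩ := exists_basis_eq_intRing_basis p
      (Module.Free.chooseBasis (intRing p F) (intRing p E))
    refine Subtype.ext (hρ.injective (B.ext fun k => ?_))
    rw [hB]
    exact congrArg Subtype.val (h _)

theorem IsHopfGalois.finite_associatedOrder (hρ : IsHopfGalois ρ) :
    Module.Finite (intRing p F) (associatedOrder p ρ) :=
  have := hρ.faithfulSMul_associatedOrder (p := p)
  .of_injective (Algebra.lsmul (intRing p F) (intRing p F) (intRing p E)).toLinearMap
    fun _ _ h => eq_of_smul_eq_smul (LinearMap.congr_fun h)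

end Finite

variable {K K' L L' : Type*} [Field K] [Field K'] [Field L] [Field L'] [Algebra K K'] [Algebra K L]
  [Algebra K L'] [Algebra K' L'] [Algebra L L'] [IsScalarTower K K' L'] [IsScalarTower K L L']
  [Algebra.IsPushout K K' L L'] [Algebra ℤ_[p] K] [Algebra ℤ_[p] K'] [Algebra ℤ_[p] L]
  [Algebra ℤ_[p] L'] [IsScalarTower ℤ_[p] K K'] [IsScalarTower ℤ_[p] K L] [IsScalarTower ℤ_[p] K L']
  [IsScalarTower ℤ_[p] K' L'] [IsScalarTower ℤ_[p] L L']
  [Algebra.IsPushout (intRing p K) (intRing p K') (intRing p L) (intRing p L')]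

section Membership

variable {H : Type*} [Ring H] [HopfAlgebra K H] (ρ : HopfAction K L H)

variable (L) in
include L in
theorem mem_associatedOrder_baseChangeAction_iff (t : K' ⊗[K] H) :
    t ∈ associatedOrder p (baseChangeAction K' L' ρ) ↔
      ∀ x : intRing p L, baseChangeAction K' L' ρ t (algebraMap L L' x) ∈ intRing p L' := by
  refine ⟨fun ht x => ht _ (algebraMap (intRing p L) (intRing p L') x).2, fun ht y hy => ?_⟩
  lift y to intRing p L' using hy
  obtain ⟨s, rfl⟩ := (Algebra.IsPushout.equiv (intRing p K) (intRing p K') (intRing p L)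
    (intRing p L')).surjective y
  induction s with
  | zero => simp
  | add r s hr hs => simpa using add_mem hr hs
  | tmul a x =>
    rw [Algebra.IsPushout.equiv_tmul, MulMemClass.coe_mul, coe_algebraMap_intRing,
      coe_algebraMap_intRing, ← Algebra.smul_def, map_smul, Algebra.smul_def]
    exact mul_mem (algebraMap (intRing p K') (intRing p L') a).2 (ht x)

variable {κ : Type*} [Fintype κ] {b : Module.Basis κ (intRing p K) (intRing p K')}
  {B : Module.Basis κ K K'} (hB : ∀ k, B k = b k)

include hB in
theorem sum_smul_mem_intRing_iff (x : κ → L) :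
    ∑ k, B k • algebraMap L L' (x k) ∈ intRing p L' ↔ ∀ k, x k ∈ intRing p L := by
  have hL := (isBaseChange_iff_bijective_sum_smul B
    (IsScalarTower.toAlgHom K L L').toLinearMap).1 Algebra.IsPushout.out
  have hO := (isBaseChange_iff_bijective_sum_smul b (IsScalarTower.toAlgHom (intRing p K)
    (intRing p L) (intRing p L')).toLinearMap).1 Algebra.IsPushout.out
  have hcoe (x : κ → intRing p L) : ((∑ k, b k • algebraMap (intRing p L) (intRing p L') (x k) :
      intRing p L') : L') = ∑ k, B k • algebraMap L L' (x k) := by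
    simp [hB, Algebra.smul_def]
  constructor
  · intro hx
    obtain ⟨m, hm⟩ := hO.2 ⟨_, hx⟩
    have : (fun k => (m k : L)) = x := hL.1 ((hcoe m).symm.trans (congrArg Subtype.val hm))
    exact fun k => this ▸ (m k).2
  · intro hx
    lift x to κ → intRing p L using hx
    exact hcoe x ▸ Subtype.property _

include hB in
theorem sum_tmul_mem_associatedOrder_iff (h : κ → H) :
    ∑ k, B k ⊗ₜ[K] h k ∈ associatedOrder p (baseChangeAction K' L' ρ) ↔
      ∀ k, h k ∈ associatedOrder p ρ := by
  simp only [mem_associatedOrder_baseChangeAction_iff p L, map_sum, LinearMap.sum_apply,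
    baseChangeAction_tmul_algebraMap, sum_smul_mem_intRing_iff p hB]
  exact ⟨fun H k x hx => H ⟨x, hx⟩ k, fun H x k => H k x x.2⟩

end Membership

section Inclusion

variable {H : Type*} [Ring H] [HopfAlgebra K H] (ρ : HopfAction K L H)

instance : IsScalarTower (intRing p K) (intRing p K') (K' ⊗[K] H) := .of_algebraMap_eq fun _ => rfl

variable (K' L') in
/-- The inclusion `h ↦ 1 ⊗ h` of `𝔄_H` in the associated order of the base change `K' ⊗ H`. -/
def associatedOrderInclusion :
    associatedOrder p ρ →ₐ[intRing p K] associatedOrder p (baseChangeAction K' L' ρ) :=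
  (((Algebra.TensorProduct.includeRight : H →ₐ[K] K' ⊗[K] H).restrictScalars (intRing p K)).comp
    (associatedOrder p ρ).val).codRestrict
      ((associatedOrder p (baseChangeAction K' L' ρ)).restrictScalars (intRing p K)) fun h =>
        (mem_associatedOrder_baseChangeAction_iff p L ρ _).2 fun x => by
          change baseChangeAction K' L' ρ (1 ⊗ₜ h.1) _ ∈ _
          rw [baseChangeAction_tmul_algebraMap, one_smul]
          exact (algebraMap (intRing p L) (intRing p L') ⟨_, h.2 x x.2⟩).2

theorem coe_smul_associatedOrderInclusion (a : intRing p K') (h : associatedOrder p ρ) :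
    ((a • associatedOrderInclusion p K' L' ρ h : associatedOrder p (baseChangeAction K' L' ρ)) :
      K' ⊗[K] H) = (a : K') ⊗ₜ (h : H) := by
  change (a : K') • ((1 : K') ⊗ₜ[K] (h : H)) = _
  rw [TensorProduct.smul_tmul', smul_eq_mul, mul_one]

variable [Algebra ℚ_[p] K] [Algebra ℚ_[p] K'] [FiniteDimensional ℚ_[p] K]
  [FiniteDimensional ℚ_[p] K'] [IsScalarTower ℤ_[p] ℚ_[p] K] [IsScalarTower ℤ_[p] ℚ_[p] K']

theorem isBaseChange_associatedOrderInclusion :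
    IsBaseChange (intRing p K') (associatedOrderInclusion p K' L' ρ).toLinearMap := by
  let b := Module.Free.chooseBasis (intRing p K) (intRing p K')
  obtain ⟨B, hB⟩ := exists_basis_eq_intRing_basis p b
  have hH := (isBaseChange_iff_bijective_sum_smul B _).1 (TensorProduct.isBaseChange K H K')
  simp only [TensorProduct.mk_apply, TensorProduct.smul_tmul', smul_eq_mul, mul_one] at hH
  rw [isBaseChange_iff_bijective_sum_smul b]
  have hcoe (h : _ → associatedOrder p ρ) :
      ((∑ k, b k • associatedOrderInclusion p K' L' ρ (h k) :
        associatedOrder p (baseChangeAction K' L' ρ)) : K' ⊗[K] H) = ∑ k, B k ⊗ₜ[K] (h k : H) := by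
    rw [AddSubmonoidClass.coe_finsetSum]
    exact Finset.sum_congr rfl fun k _ => by rw [coe_smul_associatedOrderInclusion, hB]
  constructor
  · intro h h' hh
    have := hH.1 ((hcoe h).symm.trans ((congrArg Subtype.val hh).trans (hcoe h')))
    exact funext fun k => Subtype.ext (congrFun this k)
  · rintro ⟨t, ht⟩
    obtain ⟨h, rfl⟩ := hH.2 t
    have hmem := (sum_tmul_mem_associatedOrder_iff p ρ hB h).1 ht
    exact ⟨fun k => ⟨h k, hmem k⟩, Subtype.ext (hcoe _)⟩

theorem exists_associatedOrder_baseChangeAction_algEquiv :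
    ∃ Φ : (intRing p K' ⊗[intRing p K] associatedOrder p ρ) ≃ₐ[intRing p K']
        associatedOrder p (baseChangeAction K' L' ρ),
      ∀ (a : intRing p K') (h : associatedOrder p ρ),
        (Φ (a ⊗ₜ[intRing p K] h) : K' ⊗[K] H) = (a : K') ⊗ₜ[K] (h : H) := by
  let e := (isBaseChange_associatedOrderInclusion (K' := K') (L' := L') p ρ).equiv
  have he (a : intRing p K') (h : associatedOrder p ρ) :
      (e (a ⊗ₜ h) : K' ⊗[K] H) = (a : K') ⊗ₜ (h : H) := by
    rw [IsBaseChange.equiv_tmul]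
    exact coe_smul_associatedOrderInclusion p ρ a h
  refine ⟨Algebra.TensorProduct.algEquivOfLinearEquivTensorProduct e (fun a c g h => ?_) ?_, he⟩
  · exact Subtype.ext (by simp [he])
  · exact Subtype.ext (he 1 1)

end Inclusion

section Freeness

variable [Algebra ℚ_[p] K] [Algebra ℚ_[p] K'] [Algebra ℚ_[p] L] [FiniteDimensional ℚ_[p] K]
  [FiniteDimensional ℚ_[p] K'] [FiniteDimensional ℚ_[p] L] [IsScalarTower ℤ_[p] ℚ_[p] K]
  [IsScalarTower ℤ_[p] ℚ_[p] K'] [IsScalarTower ℤ_[p] ℚ_[p] L]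

attribute [local instance] associatedOrderModule

theorem isFreeOverAssociatedOrder_baseChangeAction_iff {H : Type*} [Ring H] [HopfAlgebra K H]
    {ρ : HopfAction K L H} (hρ : IsHopfGalois ρ) (hH : ∀ a b : H, a * b = b * a) :
    IsFreeOverAssociatedOrder p (baseChangeAction K' L' ρ) ↔ IsFreeOverAssociatedOrder p ρ := by
  have := hρ.finite_associatedOrder (p := p)
  have hH' (s t : K' ⊗[K] H) : s * t = t * s := by
    let _ : CommRing H := { ‹Ring H› with mul_comm := hH }
    exact mul_comm s t
  have : Nontrivial (associatedOrder p (baseChangeAction K' L' ρ)) :=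
    ((baseChangeAction K' L' ρ).toRingHom.comp
      (associatedOrder p (baseChangeAction K' L' ρ)).val.toRingHom).domain_nontrivial
  refine free_iff_free_of_isBaseChange_semilinear (fun a b => Subtype.ext (hH a b))
    (fun a b => Subtype.ext (hH' a b)) (isBaseChange_associatedOrderInclusion p ρ)
    (Algebra.IsPushout.out (R := intRing p K) (S := intRing p K') (R' := intRing p L))
    fun h x => Subtype.ext ?_
  change algebraMap L L' (ρ h x) = baseChangeAction K' L' ρ (1 ⊗ₜ h.1) (algebraMap L L' x)
  rw [baseChangeAction_tmul_algebraMap, one_smul]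

end Freeness
end AssociatedOrder

section Compositum

theorem isMulCommutative_of_prime_card {G : Type*} [Group G] (hG : (Nat.card G).Prime) :
    IsMulCommutative G :=
  have := Fact.mk hG
  have := isCyclic_of_prime_card (α := G) rfl
  IsCyclic.isMulCommutative

theorem eq_baseChangeAction_compositum_iff {K N : Type*} [Field K] [Field N] [Algebra K N]
    {K' L : IntermediateField K N} [Algebra.IsPushout K K' L (compositum K' L)] {H : Type*}
    [Ring H] [HopfAlgebra K H] {ρ : HopfAction K L H}
    {σ : HopfAction K' (compositum K' L) (K' ⊗[K] H)} :
    (∀ (a : K') (h : H) (x : L) (y : compositum K' L), (y : N) = x →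
      (σ (a ⊗ₜ[K] h) y : N) = a * (ρ h x : N)) ↔ σ = baseChangeAction K' _ ρ := by
  refine ⟨fun hσ => eq_baseChangeAction fun a h x => Subtype.ext (hσ a h x _ rfl), ?_⟩
  rintro rfl a h x y hy
  obtain rfl : y = algebraMap L _ x := Subtype.ext hy
  rw [baseChangeAction_tmul_algebraMap]
  rfl

end Compositum

end HopfGaloisDegP

end

theorem mainTheorem2_general (p : ℕ) [Fact p.Prime]
    (K : Type u) [Field K] [Algebra ℚ_[p] K] [FiniteDimensional ℚ_[p] K]
    [Algebra ℤ_[p] K] [IsScalarTower ℤ_[p] ℚ_[p] K]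
    (N : Type v) [Field N] [Algebra K N] [Algebra ℚ_[p] N] [IsScalarTower ℚ_[p] K N]
    [Algebra ℤ_[p] N] [IsScalarTower ℤ_[p] K N]
    (L : IntermediateField K N) (hdeg : Module.finrank K L = p)
    (hram : IsTotallyRamified p K L) (hN : IsNormalClosure K L N)
    (K' : IntermediateField K N) (hK' : K' = inertiaField p K N)
    (L' : IntermediateField K N) (hL' : L' = (inertiaField p L N).restrictScalars K) :
    ∃ hle : K' ≤ L',
      (FiniteDimensional ℚ_[p] K' ∧ FiniteDimensional ℚ_[p] L' ∧
        Module.finrank K' (IntermediateField.extendScalars hle) = p ∧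
        IsNormalClosure K' (IntermediateField.extendScalars hle) N ∧
        IsHopfGaloisExtension K' (IntermediateField.extendScalars hle)) ∧
      IsTotallyRamified p K' N ∧
      ((∃ M : IntermediateField K N, IsAlmostClassicallyGaloisWith L M) ∧
        ∀ M : IntermediateField K N, IsAlmostClassicallyGaloisWith L M →
          ∃ hM : K' ≤ M, IsAlmostClassicallyGaloisWith
            (IntermediateField.extendScalars hle) (IntermediateField.extendScalars hM)) ∧
      IsHopfGaloisExtension K L ∧
      ∀ (H : Type w) [Ring H] [HopfAlgebra K H] (ρ : HopfAction K L H),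
        IsHopfGalois ρ →
        ∃ ρ' : HopfAction K' (IntermediateField.extendScalars hle) (K' ⊗[K] H),
          (∀ σ : HopfAction K' (IntermediateField.extendScalars hle) (K' ⊗[K] H),
            (∀ (a : K') (h : H) (x : L) (y : IntermediateField.extendScalars hle),
              (y : N) = x → (σ (a ⊗ₜ[K] h) y : N) = a * (ρ h x : N)) ↔ σ = ρ') ∧
          IsUniqueHopfGalois.{z} ρ' ∧
          (∃ Φ : (intRing p K' ⊗[intRing p K] associatedOrder p ρ)
              ≃ₐ[intRing p K'] associatedOrder p ρ',
            ∀ (a : intRing p K') (h : associatedOrder p ρ),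
              (Φ (a ⊗ₜ[intRing p K] h) : K' ⊗[K] H) = (a : K') ⊗ₜ[K] (h : H)) ∧
          (IsFreeOverAssociatedOrder p ρ' ↔ IsFreeOverAssociatedOrder p ρ) := by
  have hprime : p.Prime := Fact.out
  have : FiniteDimensional K L := .of_finrank_pos (hdeg ▸ hprime.pos)
  have : FiniteDimensional K N := finiteDimensional_of_isNormalClosure hN
  have : CharZero K := charZero_of_injective_algebraMap (algebraMap ℚ_[p] K).injective
  have : Normal K N := hN.normal
  have : IsGalois K N := ⟨⟩
  have : FiniteDimensional ℚ_[p] N := .trans ℚ_[p] K N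
  have : IsScalarTower ℤ_[p] ℚ_[p] N := .to₁₂₄ ℤ_[p] ℚ_[p] K N
  obtain rfl : L' = K' ⊔ L := by rw [hL', hK', restrictScalars_inertiaField]
  subst hK'
  have hJ := isComplement'_wildInertiaGroup hdeg hram hN
  have hJI := wildInertiaGroup_le_inertiaGroup p K N
  have hJK' := hJI.trans (fixingSubgroup_inertiaField p).ge
  have hJ' := isComplement'_compositum hJ hJK'
  have hdeg' := (finrank_compositum hJ hJK').trans hdeg
  have hcard := finrank_eq_card_of_isComplement' hJ ▸ hdeg.symm ▸ hprime
  have hcard' := finrank_eq_card_of_isComplement' hJ' ▸ hdeg'.symm ▸ hprime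
  have := isMulCommutative_of_prime_card hcard
  have := isMulCommutative_of_prime_card hcard'
  have := isPushout_compositum hJ hJK'
  have := isPushout_intRing_compositum p L hJ hJI
  refine ⟨le_sup_left, ⟨inferInstance, inferInstance, hdeg', isNormalClosure_compositum hN hJ hJK',
    isHopfGaloisExtension_of_isComplement' hJ'⟩, isTotallyRamified_inertiaField p K N,
    ⟨⟨_, inferInstance, hN, _, inferInstance, hJ, rfl⟩, fun M hM => ?_⟩,
    isHopfGaloisExtension_of_isComplement' hJ, fun H _ _ ρ hρ => ?_⟩
  · have hle := inertiaField_le_of_isAlmostClassicallyGaloisWith hdeg hram hM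
    exact ⟨hle, hM.compositum hle⟩
  · exact ⟨baseChangeAction _ _ ρ, fun σ => eq_baseChangeAction_compositum_iff,
      hρ.baseChangeAction.isUniqueHopfGalois hJ' hcard',
      exists_associatedOrder_baseChangeAction_algEquiv p ρ,
      isFreeOverAssociatedOrder_baseChangeAction_iff p hρ (hρ.mul_comm hJ hcard)⟩

theorem mainTheorem2 (p : ℕ) [Fact p.Prime] (hp : p ≠ 2)
    -- `K` is a `p`-adic field and `N/K` is an extension
    (K : Type u) [Field K] [Algebra ℚ_[p] K] [FiniteDimensional ℚ_[p] K]
    [Algebra ℤ_[p] K] [IsScalarTower ℤ_[p] ℚ_[p] K]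
    (N : Type v) [Field N] [Algebra K N] [Algebra ℚ_[p] N] [IsScalarTower ℚ_[p] K N]
    [Algebra ℤ_[p] N] [IsScalarTower ℤ_[p] K N]
    -- `L/K` is totally ramified of degree `p` and `N` is its normal closure
    (L : IntermediateField K N) (hdeg : Module.finrank K L = p)
    (hram : IsTotallyRamified p K L) (hN : IsNormalClosure K L N)
    -- `K'` and `L'` are the inertia fields of `N/K` and `N/L`, as subfields of `N`
    (K' : IntermediateField K N) (hK' : K' = inertiaField p K N)
    (L' : IntermediateField K N) (hL' : L' = (inertiaField p L N).restrictScalars K) :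
    ∃ hle : K' ≤ L',
      -- `L'/K'` is a degree `p` extension of `p`-adic fields with normal closure `N`,
      -- and it is Hopf-Galois
      (FiniteDimensional ℚ_[p] K' ∧ FiniteDimensional ℚ_[p] L' ∧
        Module.finrank K' (IntermediateField.extendScalars hle) = p ∧
        IsNormalClosure K' (IntermediateField.extendScalars hle) N ∧
        IsHopfGaloisExtension K' (IntermediateField.extendScalars hle)) ∧
      -- `N/K'` is totally ramified
      IsTotallyRamified p K' N ∧
      -- `L/K` has a Galois complement, and `L'/K'` is almost classically Galois with the
      -- same complement
      ((∃ M : IntermediateField K N, IsAlmostClassicallyGaloisWith L M) ∧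
        ∀ M : IntermediateField K N, IsAlmostClassicallyGaloisWith L M →
          ∃ hM : K' ≤ M, IsAlmostClassicallyGaloisWith
            (IntermediateField.extendScalars hle) (IntermediateField.extendScalars hM)) ∧
      -- `L/K` admits a Hopf-Galois structure, and for every such structure `H`:
      IsHopfGaloisExtension K L ∧
      ∀ (H : Type w) [Ring H] [HopfAlgebra K H] (ρ : HopfAction K L H),
        IsHopfGalois ρ →
        -- the action of `H` on `L` extends to exactly one `K'`-linear action of the `K'`-Hopf
        -- algebra `K' ⊗ H` on `L'`,
        ∃ ρ' : HopfAction K' (IntermediateField.extendScalars hle) (K' ⊗[K] H),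
          (∀ σ : HopfAction K' (IntermediateField.extendScalars hle) (K' ⊗[K] H),
            (∀ (a : K') (h : H) (x : L) (y : IntermediateField.extendScalars hle),
              (y : N) = x → (σ (a ⊗ₜ[K] h) y : N) = a * (ρ h x : N)) ↔ σ = ρ') ∧
          -- which is the unique Hopf-Galois structure on `L'/K'`;
          IsUniqueHopfGalois.{z} ρ' ∧
          -- the associated order of `K' ⊗ H` is `𝒪_{K'} ⊗ 𝔄_H`, via `a ⊗ h ↦ a ⊗ h`;
          (∃ Φ : (intRing p K' ⊗[intRing p K] associatedOrder p ρ)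
              ≃ₐ[intRing p K'] associatedOrder p ρ',
            ∀ (a : intRing p K') (h : associatedOrder p ρ),
              (Φ (a ⊗ₜ[intRing p K] h) : K' ⊗[K] H) = (a : K') ⊗ₜ[K] (h : H)) ∧
          -- and freeness over the associated orders is equivalent
          (IsFreeOverAssociatedOrder p ρ' ↔ IsFreeOverAssociatedOrder p ρ) :=
  mainTheorem2_general p K N L hdeg hram hN K' hK' L' hL'
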